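/- **Setting.** Let $p\ge 1$ and let $$r(z)=r_\infty+\sum_{l=1}^k\sum_{j=1}^{m_l}\frac{r_{lj}}{(1-zw_l)^j},\qquad \operatorname{Re} w_l>0,$$ be an A-acceptable rational approximation to the exponential of order $p$, i.e. $|r(z)|\le 1$ for $\operatorname{Re} z\le 0$ and $r(z)-e^z=O(z^{p+1})$ as $z\to 0$. For $R(z)=\sum_j R_jz^j$ analytic near $0$ and pairwise distinct nodes $c_1,\dots,c_q\in\mathbb R$, the *Vandermonde weights* are the solution $\gamma\in\mathbb C^q$ of $\sum_s c_s^j\gamma_s=j!\,R_j$, $0\le j\le q-1$. For $c\in\mathbb R^p$ and $d\in\mathbb R^{p+1}$ with pairwise distinct components, let $\gamma_{l,i}(c)\in\mathbb C^p$ and $\eta_{l,i}(d)\in\mathbb C^{p+1}$ be the Vandermonde weights for $(1-w_lz)^{-i}$ with nodes $c$ and for $z(1-w_lz)^{-i}$ with nodes $d$, respectively ($1\le l\le k$, $1\le i\le m_l$). Let $C_{ub}^m$ be the space of $C^m$ functions $h:[0,\infty)\to\mathbb C$ such that $h,\dots,h^{(m)}$ are bounded and uniformly continuous, and let $Bh=h'$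 on $D(B)=C^1_{ub}$ be the generator of the translation semigroup on $C_{ub}^0$. Let $\kappa(c,d)\in[0,\infty]$ be the least constant $\kappa$ such that, for all $\tau>0$, $1\le l\le k$, $1\le i\le m_l$ and $t\ge0$, $$\Big|\big[(I-\tau w_lB)^{-i}h(t+\cdot)\big](0)-\sum_{s=1}^{p}\gamma_{l,i,s}(c)\,h(t+\tau c_s)\Big|\le\kappa\,\tau^p\sup_{[0,\infty)}|h^{(p)}|\qquad (h\in C^p_{ub})$$ whenever $t+\tau c_s\ge0$ for all $s$, and $$\Big|\big[\tau B(I-\tau w_lB)^{-i}h(t+\cdot)\big](0)-\sum_{s=1}^{p+1}\eta_{l,i,s}(d)\,h(t+\tau d_s)\Big|\le\kappa\,\tau^{p+1}\sup_{[0,\infty)}|h^{(p+1)}|\qquad (h\in C^{p+1}_{ub})$$ whenever $t+\tau d_s\ge0$ for all $s$. Let $X,Y$ be complex Banach spaces, let $A_0$ generate a $C_0$-semigroup $S(t)$ on $X$ with $\|S(t)\|\le Me^{\omega t}$ for $t\ge0$, where $M\ge1$ and $\omega<0$, and let $K:Y\to X$ be bounded and linear. Put $r(\tau A_0)=r_\infty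 I+\sum_{l,j}r_{lj}(I-\tau w_lA_0)^{-j}$ and assume $C_s:=\sup_{\tau>0,\,n\ge0}\|r(\tau A_0)^n\|<\infty$. Fix $\tau>0$, put $t_n=n\tau$, and choose nodes $c_n\in\mathbb R^p$, $d_n\in\mathbb R^{p+1}$ $(n\ge0)$, each with pairwise distinct components, such that $t_n+\tau c_n\ge0$ and $t_n+\tau d_n\ge0$ componentwise and $\bar\kappa:=\sup_n\kappa(c_n,d_n)<\infty$. The *rational-like (RL) method* for $u'=A_0u+f-Kg'$ on $[0,\infty)$ is $\bar u_0=u(0)$, $$\bar u_{n+1}=r(\tau A_0)\bar u_n+\tau E_n-F_n,\qquad n\ge0,$$ $$E_n=\sum_{l=1}^k\sum_{j=1}^{m_l}r_{lj}w_l\sum_{i=1}^j(I-\tau w_lA_0)^{-(j-i+1)}\sum_{s=1}^p\gamma_{l,i,s}(c_n)f(t_n+\tau c_{n,s}),$$ $$F_n=\sum_{l=1}^k\sum_{j=1}^{m_l}r_{lj}w_l\sum_{i=1}^j(I-\tau w_lA_0)^{-(j-i+1)}K\sum_{s=1}^{p+1}\eta_{l,i,s}(d_n)g(t_n+\tau d_{n,s}),$$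 so it uses only point values of $f$ and $g$. Write $\|h\|_{m,t}=\max_{0\le j\le m}\sup_{0\le s\le t}\|h^{(j)}(s)\|$. **Theorem.** $\kappa(c,d)<\infty$ for all $c\in\mathbb R^p$, $d\in\mathbb R^{p+1}$ with pairwise distinct components. Moreover, there are constants $C_{el},C_{aux}>0$ depending only on $r$ and $p$ such that the following holds for all data as above. If $f\in C^{p+1}([0,\infty),X)$, $g\in C^{p+2}([0,\infty),Y)$ and the solution $u$ of $u'=A_0u+f-Kg'$ belongs to $C^{p+1}([0,\infty),X)$, then for every $n\ge1$ and every $T\ge t_n$ such that all the nodes $t_j+\tau c_{j,s}$, $t_j+\tau d_{j,s}$ of the first $n$ steps $0\le j\le n-1$ are $\le T$, $$\|u(t_n)-\bar u_n\|\le C_c\,\tau^p\,t_n(1+2t_n)\big(\|u\|_{p+1,t_n}+\|f\|_{p+1,T}+\|g\|_{p+2,T}\big),$$ $$C_c=C_s\,M\big(C_{el}+\bar\kappa\,C_{aux}(1+\|K\|)\big).$$ In particular, the method has order $p$, without order reduction. If none of the nodes of the first $n$ steps exceeds $t_n$, one may take $T=t_n$. -/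

import Mathlib

open Set Filter Topology Asymptotics
open scoped NNReal ENNReal

noncomputable section

/-! ### Semigroups, generators, resolvents -/

/-- A strongly continuous one-parameter semigroup of bounded linear operators on `X`
(only the values at times `t ≥ 0` are meaningful). -/
structure C0Semigroup (X : Type*) [NormedAddCommGroup X] [NormedSpace ℂ X] where
  toFun : ℝ → X →L[ℂ] X
  map_zero : toFun 0 = ContinuousLinearMap.id ℂ X
  map_add : ∀ s t : ℝ, 0 ≤ s → 0 ≤ t → toFun (s + t) = (toFun s).comp (toFun t)
  tendsto_zero : ∀ x : X, Tendsto (fun t => toFun t x) (𝓝[>] 0) (𝓝 x)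

/-- `A` is the infinitesimal generator of the semigroup `S`: `x ∈ D(A)` and `A x = y` if and only
if `(S(h) x - x) / h → y` as `h → 0+`. -/
def IsInfinitesimalGenerator {X : Type*} [NormedAddCommGroup X] [NormedSpace ℂ X]
    (A : X →ₗ.[ℂ] X) (S : C0Semigroup X) : Prop :=
  ∀ x y : X, (x, y) ∈ A.graph ↔
    Tendsto (fun h : ℝ => (h : ℂ)⁻¹ • (S.toFun h x - x)) (𝓝[>] 0) (𝓝 y)

/-- The bounded operator `R` is a two-sided inverse of `I - z A : D(A) → X`. -/
def IsInverseOneSub {X : Type*} [NormedAddCommGroup X] [NormedSpace ℂ X]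
    (A : X →ₗ.[ℂ] X) (z : ℂ) (R : X →L[ℂ] X) : Prop :=
  (∀ x : X, ∃ hx : R x ∈ A.domain, R x - z • A ⟨R x, hx⟩ = x) ∧
    ∀ x : A.domain, R ((x : X) - z • A x) = x

theorem IsInverseOneSub.unique {X : Type*} [NormedAddCommGroup X] [NormedSpace ℂ X]
    {A : X →ₗ.[ℂ] X} {z : ℂ} {R R' : X →L[ℂ] X}
    (h : IsInverseOneSub A z R) (h' : IsInverseOneSub A z R') : R = R' := by
  ext x
  obtain ⟨hx, hxe⟩ := h.1 x
  have := h'.2 ⟨R x, hx⟩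
  rw [hxe] at this
  exact this.symm

open Classical in
/-- The operator `(I - z A)⁻¹` (and `0` if `I - z A` has no bounded inverse). -/
def invOneSub {X : Type*} [NormedAddCommGroup X] [NormedSpace ℂ X]
    (A : X →ₗ.[ℂ] X) (z : ℂ) : X →L[ℂ] X :=
  if h : ∃ R : X →L[ℂ] X, IsInverseOneSub A z R then h.choose else 0

theorem invOneSub_eq {X : Type*} [NormedAddCommGroup X] [NormedSpace ℂ X]
    {A : X →ₗ.[ℂ] X} {z : ℂ} {R : X →L[ℂ] X} (h : IsInverseOneSub A z R) :
    invOneSub A z = R := by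
  have hex : ∃ R : X →L[ℂ] X, IsInverseOneSub A z R := ⟨R, h⟩
  unfold invOneSub
  rw [dif_pos hex]
  exact hex.choose_spec.unique h

/-! ### Rational functions in partial fractions -/

/-- The data of a rational function in simple fractions
`r(z) = r∞ + ∑_{l} ∑_{1 ≤ j ≤ m_l} r_{lj} / (1 - z w_l)^j` with `Re w_l > 0`, i.e. a rational
function that is bounded at infinity and has all its poles `1 / w_l` in the open right half
plane. Only the coefficients `coeff l j` with `1 ≤ j ≤ m l` are used. -/
structure SimpleFractions where
  k : ℕ
  m : Fin k → ℕ
  w : Fin k → ℂ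
  re_w_pos : ∀ l, 0 < (w l).re
  rInf : ℂ
  coeff : Fin k → ℕ → ℂ

/-- The value `r(z)`. -/
def SimpleFractions.eval (r : SimpleFractions) (z : ℂ) : ℂ :=
  r.rInf + ∑ l, ∑ j ∈ Finset.Icc 1 (r.m l), r.coeff l j / (1 - z * r.w l) ^ j

/-- A-acceptability: `|r(z)| ≤ 1` for `Re z ≤ 0`. -/
def SimpleFractions.AAcceptable (r : SimpleFractions) : Prop :=
  ∀ z : ℂ, z.re ≤ 0 → ‖r.eval z‖ ≤ 1

/-- Order `p`: `r(z) - exp z = O(z^(p+1))` as `z → 0`. -/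
def SimpleFractions.HasOrder (r : SimpleFractions) (p : ℕ) : Prop :=
  (fun z : ℂ => r.eval z - Complex.exp z) =O[𝓝 0] fun z : ℂ => z ^ (p + 1)

/-- The operator
`r(τ A) = r∞ I + ∑_{l} ∑_{1 ≤ j ≤ m_l} r_{lj} (I - τ w_l A)^{-j}`. -/
def SimpleFractions.evalOp {X : Type*} [NormedAddCommGroup X] [NormedSpace ℂ X]
    (r : SimpleFractions) (A : X →ₗ.[ℂ] X) (τ : ℝ) : X →L[ℂ] X :=
  r.rInf • ContinuousLinearMap.id ℂ X +
    ∑ l, ∑ j ∈ Finset.Icc 1 (r.m l), r.coeff l j • invOneSub A ((τ : ℂ) * r.w l) ^ j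

/-- The stability constant `C_s(r, A) = sup_{τ > 0, n ≥ 0} ‖r(τ A)^n‖ ∈ [0, ∞]`. -/
def stabilityConst {X : Type*} [NormedAddCommGroup X] [NormedSpace ℂ X]
    (r : SimpleFractions) (A : X →ₗ.[ℂ] X) : ℝ≥0∞ :=
  ⨆ (τ : ℝ) (_ : 0 < τ) (n : ℕ), ‖r.evalOp A τ ^ n‖ₑ

/-! ### Vandermonde weights -/

/-- The solution `γ` of the Vandermonde system `∑ i, c_i ^ j * γ_i = j! R_j`, `0 ≤ j ≤ q - 1`,
where the `R_j` are the Taylor coefficients of `R` at `0` (so that `j! R_j` is the `j`-th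
derivative of `R` at `0`). -/
def vandermondeWeights {q : ℕ} (R : ℂ → ℂ) (c : Fin q → ℝ) : Fin q → ℂ :=
  Matrix.mulVec (Matrix.vandermonde fun i => (c i : ℂ)).transpose⁻¹
    (fun j => iteratedDeriv (j : ℕ) R 0)

theorem vandermondeWeights_spec {q : ℕ} (R : ℂ → ℂ) {c : Fin q → ℝ}
    (hc : Function.Injective c) (j : Fin q) :
    ∑ i, (c i : ℂ) ^ (j : ℕ) * vandermondeWeights R c i = iteratedDeriv (j : ℕ) R 0 := by
  have hdet : IsUnit (Matrix.vandermonde fun i => (c i : ℂ)).transpose.det := by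
    rw [Matrix.det_transpose, isUnit_iff_ne_zero, Matrix.det_vandermonde_ne_zero_iff]
    exact Complex.ofReal_injective.comp hc
  have h : Matrix.mulVec (Matrix.vandermonde fun i => (c i : ℂ)).transpose
      (vandermondeWeights R c) = fun j : Fin q => iteratedDeriv (j : ℕ) R 0 := by
    unfold vandermondeWeights
    rw [Matrix.mulVec_mulVec, Matrix.mul_nonsing_inv _ hdet, Matrix.one_mulVec]
  simpa [Matrix.mulVec, dotProduct, Matrix.vandermonde_apply] using congrFun h j

/-- The weights `γ_{l,i}`, for the rational function `(1 - w_l z)^{-i}`. -/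
def gammaWeights (r : SimpleFractions) {q : ℕ} (c : Fin q → ℝ) (l : Fin r.k) (i : ℕ) :
    Fin q → ℂ :=
  vandermondeWeights (fun z => ((1 - r.w l * z) ^ i)⁻¹) c

/-- The weights `η_{l,i}`, for the rational function `z (1 - w_l z)^{-i}`. -/
def etaWeights (r : SimpleFractions) {q : ℕ} (d : Fin q → ℝ) (l : Fin r.k) (i : ℕ) :
    Fin q → ℂ :=
  vandermondeWeights (fun z => z * ((1 - r.w l * z) ^ i)⁻¹) d

/-! ### The rational-like (RL) method -/

/-- The operator `E_n(τ)` applied to `f(t + ·)`, with `t = t_n` and nodes `c = c_n`: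
`∑_{l} ∑_{1 ≤ j ≤ m_l} r_{lj} w_l ∑_{1 ≤ i ≤ j} (I - τ w_l A)^{-(j - i + 1)}
(∑_s γ_{l,i,s} f(t + τ c_s))`. -/
def opE {X : Type*} [NormedAddCommGroup X] [NormedSpace ℂ X]
    (r : SimpleFractions) (A : X →ₗ.[ℂ] X) (τ t : ℝ) {q : ℕ} (c : Fin q → ℝ) (f : ℝ → X) : X :=
  ∑ l, ∑ j ∈ Finset.Icc 1 (r.m l), (r.coeff l j * r.w l) •
    ∑ i ∈ Finset.Icc 1 j, (invOneSub A ((τ : ℂ) * r.w l) ^ (j - i + 1))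
      (∑ s, gammaWeights r c l i s • f (t + τ * c s))

/-- The operator `F_n(τ)` applied to `g(t + ·)`, with `t = t_n` and nodes `d = d_n`:
`∑_{l} ∑_{1 ≤ j ≤ m_l} r_{lj} w_l ∑_{1 ≤ i ≤ j} (I - τ w_l A)^{-(j - i + 1)} K
(∑_s η_{l,i,s} g(t + τ d_s))`. -/
def opF {X Y : Type*} [NormedAddCommGroup X] [NormedSpace ℂ X] [NormedAddCommGroup Y]
    [NormedSpace ℂ Y] (r : SimpleFractions) (A : X →ₗ.[ℂ] X) (K : Y →L[ℂ] X) (τ t : ℝ) {q : ℕ}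
    (d : Fin q → ℝ) (g : ℝ → Y) : X :=
  ∑ l, ∑ j ∈ Finset.Icc 1 (r.m l), (r.coeff l j * r.w l) •
    ∑ i ∈ Finset.Icc 1 j, (invOneSub A ((τ : ℂ) * r.w l) ^ (j - i + 1))
      (K (∑ s, etaWeights r d l i s • g (t + τ * d s)))

/-- The RL approximations: `ū_0 = u₀` and
`ū_{n+1} = r(τ A) ū_n + τ E_n(τ) f(t_n + ·) - F_n(τ) g(t_n + ·)`, with `t_n = n τ`. -/
def rlMethod {X Y : Type*} [NormedAddCommGroup X] [NormedSpace ℂ X] [NormedAddCommGroup Y]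
    [NormedSpace ℂ Y] (r : SimpleFractions) (A : X →ₗ.[ℂ] X) (K : Y →L[ℂ] X) {p : ℕ} (τ : ℝ)
    (c : ℕ → Fin p → ℝ) (d : ℕ → Fin (p + 1) → ℝ) (f : ℝ → X) (g : ℝ → Y) (u₀ : X) : ℕ → X
  | 0 => u₀
  | n + 1 => r.evalOp A τ (rlMethod r A K τ c d f g u₀ n)
      + (τ : ℂ) • opE r A τ (n * τ) (c n) f - opF r A K τ (n * τ) (d n) g

/-! ### Norms and function spaces on the half line -/

/-- `‖h‖_{m,t} = max_{0 ≤ j ≤ m} sup_{0 ≤ s ≤ t} ‖h^{(j)}(s)‖` for `h : [0,∞) → Z` of class `C^m`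
(one-sided derivatives at `0`). -/
def cmNorm {Z : Type*} [NormedAddCommGroup Z] [NormedSpace ℂ Z] (m : ℕ) (t : ℝ) (h : ℝ → Z) : ℝ :=
  ⨆ j : Fin (m + 1), ⨆ s : Icc (0 : ℝ) t, ‖iteratedDerivWithin (j : ℕ) h (Ici 0) (s : ℝ)‖

/-- The class `C_ub^m([0,∞), ℂ)`: `h` is `C^m` and `h^{(j)}`, `0 ≤ j ≤ m`, are bounded and uniformly
continuous on `[0,∞)`. -/
def IsCub (m : ℕ) (h : ℝ → ℂ) : Prop :=
  ContDiffOn ℝ m h (Ici 0) ∧ ∀ j ≤ m,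
    (∃ b : ℝ, ∀ s ∈ Ici (0 : ℝ), ‖iteratedDerivWithin j h (Ici 0) s‖ ≤ b) ∧
    UniformContinuousOn (iteratedDerivWithin j h (Ici 0)) (Ici 0)

/-- On `[0,∞)`, `φ = (I - τ w B)^{-i} ψ`, where `B h = h'`, `D(B) = C_ub^1([0,∞), ℂ)`, is the
generator of the semigroup of translations on `C_ub([0,∞), ℂ)`: each application of
`(I - τ w B)^{-1}` consists in finding the solution in `C_ub^1` of `φ - τ w φ' = χ`. -/
def IsShiftResolventPow (τ : ℝ) (w : ℂ) (ψ : ℝ → ℂ) : ℕ → (ℝ → ℂ) → Prop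
  | 0, φ => ∀ s ∈ Ici (0 : ℝ), φ s = ψ s
  | i + 1, φ => ∃ χ : ℝ → ℂ, IsShiftResolventPow τ w ψ i χ ∧ IsCub 1 φ ∧
      ∀ s ∈ Ici (0 : ℝ), φ s - (τ : ℂ) * w * derivWithin φ (Ici 0) s = χ s

/-- `κ` is an admissible constant for the nodes `c` and `d`: writing `L h = h(0)`, for all `τ > 0`,
all `l` and all `1 ≤ i ≤ m_l`,
* `|L (I - τ w_l B)^{-i} h(t + ·) - ∑_s γ_{l,i,s} h(t + τ c_s)| ≤ κ τ^p sup |h^{(p)}|`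
  for all `h ∈ C_ub^p([0,∞), ℂ)` and `t ≥ 0` with `t + τ c ≥ 0`;
* `|L τ B (I - τ w_l B)^{-i} h(t + ·) - ∑_s η_{l,i,s} h(t + τ d_s)| ≤ κ τ^(p+1) sup |h^{(p+1)}|`
  for all `h ∈ C_ub^(p+1)([0,∞), ℂ)` and `t ≥ 0` with `t + τ d ≥ 0`. -/
def IsNodeConst (r : SimpleFractions) {p : ℕ} (c : Fin p → ℝ) (d : Fin (p + 1) → ℝ) (κ : ℝ≥0) :
    Prop :=
  ∀ τ : ℝ, 0 < τ → ∀ l : Fin r.k, ∀ i ∈ Finset.Icc 1 (r.m l), ∀ t : ℝ, 0 ≤ t →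
    ((∀ s, 0 ≤ t + τ * c s) → ∀ h φ : ℝ → ℂ, IsCub p h →
      IsShiftResolventPow τ (r.w l) (fun x => h (t + x)) i φ →
      ‖φ 0 - ∑ s, gammaWeights r c l i s * h (t + τ * c s)‖ ≤
        κ * τ ^ p * ⨆ x : Ici (0 : ℝ), ‖iteratedDerivWithin p h (Ici 0) (x : ℝ)‖) ∧
    ((∀ s, 0 ≤ t + τ * d s) → ∀ h φ : ℝ → ℂ, IsCub (p + 1) h →
      IsShiftResolventPow τ (r.w l) (fun x => h (t + x)) i φ →
      ‖(τ : ℂ) * derivWithin φ (Ici 0) 0 - ∑ s, etaWeights r d l i s * h (t + τ * d s)‖ ≤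
        κ * τ ^ (p + 1) * ⨆ x : Ici (0 : ℝ), ‖iteratedDerivWithin (p + 1) h (Ici 0) (x : ℝ)‖)

/-- `κ(c, d) ∈ [0, ∞]`: the least admissible constant for the nodes `c` and `d`. It depends only on
`r` and on the nodes. -/
def nodeConst (r : SimpleFractions) {p : ℕ} (c : Fin p → ℝ) (d : Fin (p + 1) → ℝ) : ℝ≥0∞ :=
  ⨅ (κ : ℝ≥0) (_ : IsNodeConst r c d κ), (κ : ℝ≥0∞)

/-- `u` is a (genuine) solution on `[0,∞)` of `u' = A u + f - K g'`. -/
def IsSolution {X Y : Type*} [NormedAddCommGroup X] [NormedSpace ℂ X] [NormedAddCommGroup Y]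
    [NormedSpace ℂ Y] (A : X →ₗ.[ℂ] X) (K : Y →L[ℂ] X) (f : ℝ → X) (g : ℝ → Y) (u : ℝ → X) :
    Prop :=
  ∀ t ∈ Ici (0 : ℝ), ∃ hu : u t ∈ A.domain,
    HasDerivWithinAt u (A ⟨u t, hu⟩ + f t - K (derivWithin g (Ici 0) t)) (Ici 0) t

end

/-! The consistency argument never lets a power of the generator act on the data. Write `b_k =
u^(k)(t)` and `e_k = f^(k)(t) - K g^(k+1)(t)`. Differentiating the equation gives `b_(k+1) = A b_k +
e_k`, that is, `b_k = J (b_k - τ w (b_(k+1) - e_k))` with the bounded operator `J = (I - τ w A)⁻¹`.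
Suppose that in the method the weighted sums of point values are replaced by the truncated Taylor
series of the operators that they imitate. Then the relations above alone turn `J^j b_0` plus the
forcing terms into the truncated series of `(1 - τ w d/dt)^(-j) u` at `t`, up to terms `τ^(p+1) J^m
u^(p+1)(t)` (`resolvent_pow_add_sum`). Weighted with the coefficients of `r`, these series add up to
the Taylor polynomial of `u`, because `r` and `exp` agree to order `p`
(`SimpleFractions.HasOrder.sum_smul`). Only `u^(p+1)` enters, so there is no order reduction.

It remains to replace Taylor series by point values. Both approximate the same functional, `(I - τ w
B)^(-i) h(t + ·)` at `0` or its analogue with `τ B`. For the point values the error is controlled by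
the node constant, and for the Taylor series by an estimate for `φ - z φ' = χ` on the half line
(`IsShiftResolventPow.norm_sub_expansion_le`). Passing through this functional makes the constants
depend on the nodes only through `κ`. Since `κ` speaks of bounded scalar functions on `[0,∞)`, data
controlled on `[0,T]` are first extended with bounds independent of `T` (`exists_jet_extension`),
and vector-valued data are tested with a norming functional.

The local error is thus at most `C M (1 + κ) (1 + ‖K‖) τ^(p+1) N` (`exists_local_error_bound`), and
power boundedness of `r(τ A)` sums `n` such errors. The factor `1 + κ` becomes a multiple of `κ`
because `κ` has a positive lower bound depending only on `r` and `p`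
(`exists_pos_le_of_isNodeConst`). Finiteness of `κ` holds because the Vandermonde weights reproduce
the same Taylor series. -/

noncomputable section

/-! ### Jets -/

/-- `H k` has the derivative `H (k + 1)` on `s`, for `k < n`. -/
def IsJet {E : Type*} [NormedAddCommGroup E] [NormedSpace ℝ E] (n : ℕ) (s : Set ℝ)
    (H : ℕ → ℝ → E) : Prop :=
  ∀ k < n, ∀ x ∈ s, HasDerivWithinAt (H k) (H (k + 1) x) s x

section Jets

variable {E : Type*} [NormedAddCommGroup E] [NormedSpace ℝ E] {n : ℕ} {s : Set ℝ} {H : ℕ → ℝ → E}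

theorem IsJet.mono {m : ℕ} (h : IsJet n s H) (hm : m ≤ n) : IsJet m s H :=
  fun k hk => h k (hk.trans_le hm)

theorem IsJet.subset {s' : Set ℝ} (h : IsJet n s H) (hs : s' ⊆ s) : IsJet n s' H :=
  fun k hk x hx => (h k hk x (hs hx)).mono hs

theorem IsJet.comp_clm {F : Type*} [NormedAddCommGroup F] [NormedSpace ℝ F] (h : IsJet n s H)
    (L : E →L[ℝ] F) : IsJet n s fun k x => L (H k x) :=
  fun k hk x hx => L.hasFDerivAt.comp_hasDerivWithinAt x (h k hk x hx)

theorem ContDiffOn.isJet {h : ℝ → E} (hh : ContDiffOn ℝ n h s) (hs : UniqueDiffOn ℝ s) :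
    IsJet n s fun k => iteratedDerivWithin k h s := by
  intro k hk x hx
  have := (hh.differentiableOn_iteratedDerivWithin (m := k) (by exact_mod_cast hk) hs x
    hx).hasDerivWithinAt
  rwa [← iteratedDerivWithin_succ] at this

theorem IsJet.iteratedDerivWithin_eq (h : IsJet n s H) (hs : UniqueDiffOn ℝ s) :
    ∀ k ≤ n, ∀ x ∈ s, iteratedDerivWithin k (H 0) s x = H k x := by
  intro k
  induction k with
  | zero => intro _ x _; simp
  | succ k ih =>
    intro hk x hx
    rw [iteratedDerivWithin_succ, derivWithin_congr (ih (by omega)) (ih (by omega) x hx)]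
    exact (h k (by omega) x hx).derivWithin (hs x hx)

theorem IsJet.contDiffOn (h : IsJet (n + 1) s H) (hs : UniqueDiffOn ℝ s) :
    ContDiffOn ℝ n (H 0) s := by
  refine contDiffOn_of_differentiableOn_deriv (n := (n : ℕ∞)) fun m hm => ?_
  have hm' : m ≤ n := by exact_mod_cast hm
  refine DifferentiableOn.congr (f := H m) (fun x hx => ?_)
    (h.iteratedDerivWithin_eq hs m (by omega))
  exact (h m (by omega) x hx).differentiableWithinAt

/-- The remainder has as derivative the remainder of the shifted jet, so the mean value inequality
gains one factor `|x - t|` per order. The factorial is given up, which only affects constants. -/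
theorem IsJet.taylor [hs : OrdConnected s] {B t x : ℝ} (ht : t ∈ s) (hx : x ∈ s)
    (h : IsJet n s H) (hB : ∀ y ∈ s, ‖H n y‖ ≤ B) :
    ‖H 0 x - ∑ k ∈ Finset.range n, ((x - t) ^ k / (k.factorial : ℝ)) • H k t‖ ≤ |x - t| ^ n * B := by
  induction n generalizing H x with
  | zero => simpa using hB x hx
  | succ n ih =>
    have hB0 : 0 ≤ B := (norm_nonneg _).trans (hB t ht)
    set R : ℝ → E := fun y => H 0 y - ∑ k ∈ Finset.range (n + 1),
      ((y - t) ^ k / (k.factorial : ℝ)) • H k t with hR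
    have hsub : uIcc t x ⊆ s := hs.uIcc_subset ht hx
    have hder : ∀ y ∈ uIcc t x, HasDerivWithinAt R (H 1 y - ∑ k ∈ Finset.range n,
        ((y - t) ^ k / (k.factorial : ℝ)) • H (k + 1) t) (uIcc t x) y := by
      intro y hy
      have h1 := (h 0 (by omega) y (hsub hy)).mono hsub
      have h2 : HasDerivWithinAt (fun y => ∑ k ∈ Finset.range (n + 1),
          ((y - t) ^ k / (k.factorial : ℝ)) • H k t) (∑ k ∈ Finset.range n,
          ((y - t) ^ k / (k.factorial : ℝ)) • H (k + 1) t) (uIcc t x) y := by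
        have h3 : ∀ k, HasDerivAt (fun y : ℝ => ((y - t) ^ k / (k.factorial : ℝ)) • H k t)
            (((k : ℝ) * (y - t) ^ (k - 1) / (k.factorial : ℝ)) • H k t) y := fun k => by
          have h5 := (((hasDerivAt_id y).sub_const t).fun_pow k)
          have h4 := (h5.div_const (k.factorial : ℝ)).smul_const (H k t)
          simpa using h4
        have h4 := (HasDerivAt.fun_sum (u := Finset.range (n + 1))
          fun k _ => h3 k).hasDerivWithinAt (s := uIcc t x)
        convert h4 using 1
        rw [Finset.sum_range_succ']
        simp only [Nat.cast_zero, zero_mul, zero_div, zero_smul, add_zero]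
        refine Finset.sum_congr rfl fun k _ => ?_
        congr 1
        rw [Nat.factorial_succ]
        have : (k.factorial : ℝ) ≠ 0 := by positivity
        push_cast
        have : (k : ℝ) + 1 ≠ 0 := by positivity
        field_simp
      exact h1.sub h2
    have hbd : ∀ y ∈ uIcc t x, ‖H 1 y - ∑ k ∈ Finset.range n,
        ((y - t) ^ k / (k.factorial : ℝ)) • H (k + 1) t‖ ≤ |x - t| ^ n * B := by
      intro y hy
      have h1 : IsJet n s fun k => H (k + 1) := fun k hk => h (k + 1) (by omega)
      refine (ih (H := fun k => H (k + 1)) (hsub hy) h1 hB).trans ?_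
      exact mul_le_mul_of_nonneg_right
        (pow_le_pow_left₀ (abs_nonneg _) (abs_sub_left_of_mem_uIcc hy) n) hB0
    have := (convex_uIcc t x).norm_image_sub_le_of_norm_hasDerivWithin_le hder hbd
      left_mem_uIcc right_mem_uIcc
    have hRt : R t = 0 := by
      simp [hR, Finset.sum_range_succ']
    rw [hRt, sub_zero, Real.norm_eq_abs] at this
    calc _ ≤ _ := this
      _ = _ := by ring

theorem uniformContinuousOn_of_hasDerivWithinAt {h h' : ℝ → E} {b : ℝ}
    (hd : ∀ x ∈ Ici (0 : ℝ), HasDerivWithinAt h (h' x) (Ici 0) x)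
    (hb : ∀ x ∈ Ici (0 : ℝ), ‖h' x‖ ≤ b) : UniformContinuousOn h (Ici 0) := by
  have := (convex_Ici (0 : ℝ)).lipschitzOnWith_of_nnnorm_hasDerivWithin_le (C := b.toNNReal) hd
    fun x hx => by
      rw [← NNReal.coe_le_coe, coe_nnnorm]
      exact (hb x hx).trans (Real.le_coe_toNNReal b)
  exact this.uniformContinuousOn

theorem IsJet.isCub {H : ℕ → ℝ → ℂ} (h : IsJet (n + 1) (Ici 0) H)
    (hb : ∀ k ≤ n + 1, ∃ b : ℝ, ∀ x ∈ Ici (0 : ℝ), ‖H k x‖ ≤ b) : IsCub n (H 0) := by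
  refine ⟨h.contDiffOn (uniqueDiffOn_Ici 0), fun j hj => ?_⟩
  have he := h.iteratedDerivWithin_eq (uniqueDiffOn_Ici 0) j (by omega)
  constructor
  · obtain ⟨b, hb⟩ := hb j (by omega)
    exact ⟨b, fun x hx => by rw [he x hx]; exact hb x hx⟩
  · obtain ⟨b, hb⟩ := hb (j + 1) (by omega)
    exact (uniformContinuousOn_of_hasDerivWithinAt (h j (by omega)) hb).congr
      fun x hx => (he x hx).symm

end Jets

/-! ### The equation `φ - z φ' = χ` on the half line -/

section Resolvent

variable {E : Type*} [NormedAddCommGroup E] [NormedSpace ℂ E] {z : ℂ}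

theorem inv_re_pos (hz : 0 < z.re) : 0 < (z⁻¹).re := by
  rw [Complex.inv_re]
  have : z ≠ 0 := fun h => by simp [h] at hz
  have := Complex.normSq_pos.2 this
  positivity

theorem norm_inv_div_re_inv (hz : 0 < z.re) : ‖z⁻¹‖ / (z⁻¹).re = ‖z‖ / z.re := by
  have h0 : z ≠ 0 := fun h => by simp [h] at hz
  have : ‖z‖ ≠ 0 := by simpa using h0
  rw [Complex.inv_re, norm_inv, Complex.normSq_eq_norm_sq]
  field_simp

/-- Multiplied by `e^{-x/z}`, `e` gets the derivative `-z⁻¹ e^{-x/z} (e - z e')` and tends to `0` at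
infinity, since `e` is bounded and `Re z⁻¹ > 0`. Integrating from `s` to `∞` gives the bound. Right
derivatives suffice, so the result applies directly to semigroup orbits. -/
theorem norm_le_of_sub_smul_deriv (hz : 0 < z.re) {e e' : ℝ → E} {b B : ℝ}
    (hc : ContinuousOn e (Ici 0)) (hd : ∀ s, 0 ≤ s → HasDerivWithinAt e (e' s) (Ici s) s)
    (hb : ∀ s, 0 ≤ s → ‖e s‖ ≤ b) (hB : ∀ s, 0 ≤ s → ‖e s - z • e' s‖ ≤ B) :
    ∀ s, 0 ≤ s → ‖e s‖ ≤ ‖z‖ / z.re * B := by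
  intro s hs
  have h0 : z ≠ 0 := fun h => by simp [h] at hz
  set a := (z⁻¹).re with ha
  have hapos : 0 < a := inv_re_pos hz
  have hnexp : ∀ x : ℝ, ‖Complex.exp (-(z⁻¹ * x))‖ = Real.exp (-(a * x)) := fun x => by
    rw [Complex.norm_exp]; simp [ha]
  set F : ℝ → E := fun x => Complex.exp (-(z⁻¹ * x)) • e x with hF
  have hFd : ∀ x : ℝ, 0 ≤ x → HasDerivWithinAt F
      (-(z⁻¹ * Complex.exp (-(z⁻¹ * x))) • (e x - z • e' x)) (Ici x) x := by
    intro x hx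
    have h1 : HasDerivAt (fun x : ℝ => Complex.exp (-(z⁻¹ * x)))
        (Complex.exp (-(z⁻¹ * x)) * -(z⁻¹ * 1)) x := by
      have := (((Complex.ofRealCLM.hasDerivAt (x := x)).const_mul z⁻¹).fun_neg).cexp
      simpa using this
    have := h1.hasDerivWithinAt (s := Ici x) |>.smul (hd x hx)
    refine HasDerivWithinAt.congr_deriv (f := F) this ?_
    rw [smul_sub, smul_smul]
    have : -(z⁻¹ * Complex.exp (-(z⁻¹ * x))) * z = -Complex.exp (-(z⁻¹ * x)) := by
      field_simp
    rw [this, mul_one, mul_neg, neg_smul, neg_smul, neg_smul,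
      mul_comm z⁻¹ (Complex.exp (-(z⁻¹ * x)))]
    abel
  have hFc : ContinuousOn F (Ici 0) := by
    refine ContinuousOn.smul ?_ hc
    fun_prop
  have hB0 : 0 ≤ B := (norm_nonneg _).trans (hB 0 le_rfl)
  set G : ℝ → ℝ := fun x => ‖z⁻¹‖ * B / a * (Real.exp (-(a * s)) - Real.exp (-(a * x)))
  have hGd : ∀ x, HasDerivAt G (‖z⁻¹‖ * B * Real.exp (-(a * x))) x := by
    intro x
    have h1 : HasDerivAt (fun x : ℝ => Real.exp (-(a * x))) (Real.exp (-(a * x)) * -(a * 1)) x :=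
      (((hasDerivAt_id x).const_mul a).fun_neg).exp
    have := (h1.const_sub (Real.exp (-(a * s)))).const_mul (‖z⁻¹‖ * B / a)
    refine this.congr_deriv ?_
    field_simp
  have hdiff : ∀ x, s ≤ x → ‖F x - F s‖ ≤ ‖z⁻¹‖ * B / a * Real.exp (-(a * s)) := by
    intro x hx
    have key := image_norm_le_of_norm_deriv_right_le_deriv_boundary (a := s) (b := x)
      (f := fun y => F y - F s)
      (f' := fun y => -(z⁻¹ * Complex.exp (-(z⁻¹ * y))) • (e y - z • e' y))
      ((hFc.mono fun y hy => hs.trans hy.1).sub continuousOn_const)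
      (fun y hy => (hFd y (hs.trans hy.1)).sub_const _)
      (B := G) (B' := fun x => ‖z⁻¹‖ * B * Real.exp (-(a * x)))
      (by simp [G]) hGd
      (fun y hy => by
        rw [norm_smul, norm_neg, norm_mul, hnexp]
        calc _ ≤ ‖z⁻¹‖ * Real.exp (-(a * y)) * B := by
              gcongr; exact hB y (hs.trans hy.1)
          _ = _ := by ring)
      (right_mem_Icc.2 hx)
    refine key.trans ?_
    simp only [G]
    gcongr
    linarith [Real.exp_pos (-(a * x))]
  have hlim : Tendsto (fun x => F x) atTop (𝓝 0) := by
    have h1 : Tendsto (fun x : ℝ => b * Real.exp (-(a * x))) atTop (𝓝 0) := by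
      have := (Real.tendsto_exp_neg_atTop_nhds_zero.comp
        (tendsto_id.const_mul_atTop hapos)).const_mul b
      simpa using this
    refine squeeze_zero_norm' ?_ h1
    filter_upwards [eventually_ge_atTop 0] with x hx
    rw [norm_smul, hnexp, mul_comm]
    gcongr
    exact hb x hx
  have hFs : ‖F s‖ ≤ ‖z⁻¹‖ * B / a * Real.exp (-(a * s)) := by
    have h2 := (hlim.sub_const (F s)).norm
    rw [zero_sub, norm_neg] at h2
    refine le_of_tendsto h2 ?_
    filter_upwards [eventually_ge_atTop s] with x hx using hdiff x hx
  rw [norm_smul, hnexp, mul_comm] at hFs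
  have := le_of_mul_le_mul_right hFs (Real.exp_pos _)
  rw [← norm_inv_div_re_inv hz]
  calc _ ≤ _ := this
    _ = _ := by ring

theorem eqOn_zero_of_sub_smul_deriv (hz : 0 < z.re) {e e' : ℝ → E} {b : ℝ}
    (hc : ContinuousOn e (Ici 0)) (hd : ∀ s, 0 ≤ s → HasDerivWithinAt e (e' s) (Ici s) s)
    (hb : ∀ s, 0 ≤ s → ‖e s‖ ≤ b) (h0 : ∀ s, 0 ≤ s → e s = z • e' s) :
    ∀ s, 0 ≤ s → e s = 0 := by
  intro s hs
  have := norm_le_of_sub_smul_deriv hz hc hd hb (B := 0)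
    (fun s hs => by rw [← h0 s hs]; simp) s hs
  simpa using this

open MeasureTheory

/-- `∫₀^∞ z⁻¹ e^{-x/z} G(s + x) dx`, the bounded solution `φ` of `φ - z φ' = G`. -/
def laplaceShift (z : ℂ) (G : ℝ → E) (s : ℝ) : E :=
  ∫ x in Ioi (0 : ℝ), (z⁻¹ * Complex.exp (-(z⁻¹ * x))) • G (s + x)

theorem norm_inv_mul_exp (z : ℂ) (x : ℝ) :
    ‖z⁻¹ * Complex.exp (-(z⁻¹ * x))‖ = ‖z⁻¹‖ * Real.exp (-(z⁻¹).re * x) := by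
  rw [norm_mul, Complex.norm_exp]; simp

theorem integrableOn_laplaceShift (hz : 0 < z.re) {G : ℝ → E} (hG : Continuous G) {B : ℝ}
    (hB : ∀ s, ‖G s‖ ≤ B) (s c : ℝ) :
    IntegrableOn (fun x : ℝ => (z⁻¹ * Complex.exp (-(z⁻¹ * x))) • G (s + x)) (Ioi c) := by
  have h1 := (integrableOn_exp_mul_Ioi (neg_lt_zero.2 (inv_re_pos hz)) c).const_mul (‖z⁻¹‖ * B)
  refine Integrable.mono' h1 (Continuous.aestronglyMeasurable (by fun_prop)) ?_
  refine Eventually.of_forall fun x => ?_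
  rw [norm_smul, norm_inv_mul_exp]
  calc _ ≤ ‖z⁻¹‖ * Real.exp (-(z⁻¹).re * x) * B := by gcongr; exact hB _
    _ = _ := by ring

theorem norm_laplaceShift_le (hz : 0 < z.re) {G : ℝ → E} {B s : ℝ}
    (hB : ∀ x, s ≤ x → ‖G x‖ ≤ B) :
    ‖laplaceShift z G s‖ ≤ ‖z‖ / z.re * B := by
  have ha := neg_lt_zero.2 (inv_re_pos hz)
  have h1 := (integrableOn_exp_mul_Ioi ha 0).const_mul (‖z⁻¹‖ * B)
  have h2 := norm_integral_le_of_norm_le (f := fun x : ℝ =>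
    (z⁻¹ * Complex.exp (-(z⁻¹ * x))) • G (s + x)) h1 <| by
    filter_upwards [ae_restrict_mem measurableSet_Ioi] with x hx
    rw [norm_smul, norm_inv_mul_exp]
    have hx' : (0 : ℝ) < x := hx
    calc _ ≤ ‖z⁻¹‖ * Real.exp (-(z⁻¹).re * x) * B := by gcongr; exact hB _ (by linarith)
      _ = _ := by ring
  refine h2.trans_eq ?_
  rw [integral_const_mul, integral_exp_mul_Ioi ha, ← norm_inv_div_re_inv hz, mul_zero,
    Real.exp_zero, neg_div_neg_eq]
  ring

theorem laplaceShift_eq (z : ℂ) (G : ℝ → E) (s : ℝ) :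
    laplaceShift z G s =
      Complex.exp (z⁻¹ * s) • ∫ x in Ioi s, (z⁻¹ * Complex.exp (-(z⁻¹ * x))) • G x := by
  have h := (measurePreserving_add_left (volume : Measure ℝ) s).setIntegral_preimage_emb
    (measurableEmbedding_addLeft s)
    (fun x => (z⁻¹ * Complex.exp (-(z⁻¹ * x))) • G x) (Ioi s)
  have hpre : (fun x => s + x) ⁻¹' Ioi s = Ioi 0 := by ext; simp
  rw [hpre] at h
  rw [← h, ← integral_smul, laplaceShift]
  congr 1
  ext x
  rw [smul_smul]
  congr 1
  rw [mul_left_comm, ← Complex.exp_add]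
  push_cast
  ring_nf

/-- A substitution moves `s` from the integrand into the exponential prefactor and the lower limit
of integration, so `G` only has to be continuous. -/
theorem hasDerivAt_laplaceShift [CompleteSpace E] (hz : 0 < z.re) {G : ℝ → E} (hG : Continuous G)
    {B : ℝ} (hB : ∀ s, ‖G s‖ ≤ B) (s : ℝ) :
    HasDerivAt (laplaceShift z G) (z⁻¹ • (laplaceShift z G s - G s)) s := by
  set q : ℝ → E := fun x => (z⁻¹ * Complex.exp (-(z⁻¹ * x))) • G x with hq
  have hqc : Continuous q := by fun_prop
  have hqi : ∀ c, IntegrableOn q (Ioi c) := fun c => by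
    simpa using integrableOn_laplaceShift hz hG hB 0 c
  have hint : ∀ x, ∫ y in Ioi x, q y = (∫ y in Ioi 0, q y) - ∫ y in (0 : ℝ)..x, q y := fun x => by
    rw [intervalIntegral.integral_Ioi_sub_Ioi' (hqi 0) (hqi x) |>.symm]
    abel
  have hd : HasDerivAt (fun x => ∫ y in Ioi x, q y) (-q s) s := by
    rw [funext hint]
    have := (intervalIntegral.integral_hasDerivAt_right (hqc.intervalIntegrable 0 s)
      hqc.stronglyMeasurable.stronglyMeasurableAtFilter hqc.continuousAt)
    exact this.const_sub _
  have h1 : HasDerivAt (fun x : ℝ => Complex.exp (z⁻¹ * x)) (Complex.exp (z⁻¹ * s) * (z⁻¹ * 1)) s := by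
    have := ((Complex.ofRealCLM.hasDerivAt (x := s)).const_mul z⁻¹).cexp
    simpa using this
  have h2 := h1.smul hd
  have hfun : laplaceShift z G = (fun x : ℝ => Complex.exp (z⁻¹ * x)) • fun x => ∫ y in Ioi x, q y :=
    funext fun x => laplaceShift_eq z G x
  rw [hfun]
  convert h2 using 1
  have : Complex.exp (z⁻¹ * s) * (z⁻¹ * Complex.exp (-(z⁻¹ * s))) = z⁻¹ := by
    rw [mul_left_comm, ← Complex.exp_add, add_neg_cancel, Complex.exp_zero, mul_one]
  simp only [hq]
  rw [Pi.smul_apply', smul_neg, smul_smul, this, smul_sub, smul_smul, mul_one, mul_comm z⁻¹]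
  abel

end Resolvent

/-! ### Resolvents of generators of bounded semigroups -/

section Semigroup

variable {X : Type*} [NormedAddCommGroup X] [NormedSpace ℂ X] {S : C0Semigroup X} {M : ℝ}

/-- The semigroup law gives `‖S(t)x - S(s)x‖ ≤ M ‖S(|t-s|)x - x‖`, which reduces everything to right
continuity at `0`. -/
theorem C0Semigroup.continuousOn_orbit (hM : ∀ t, 0 ≤ t → ‖S.toFun t‖ ≤ M) (x : X) :
    ContinuousOn (fun t => S.toFun t x) (Ici 0) := by
  have h0 : ContinuousWithinAt (fun t => S.toFun t x) (Ici 0) 0 := by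
    rw [← continuousWithinAt_Ioi_iff_Ici]
    simpa [ContinuousWithinAt, S.map_zero] using S.tendsto_zero x
  have hsub : ∀ s t, 0 ≤ s → s ≤ t →
      ‖S.toFun t x - S.toFun s x‖ ≤ M * ‖S.toFun |t - s| x - x‖ := by
    intro s t hs hst
    have h1 := S.map_add s (t - s) hs (by linarith)
    rw [add_sub_cancel] at h1
    rw [h1, abs_of_nonneg (by linarith : 0 ≤ t - s), ContinuousLinearMap.comp_apply, ← map_sub]
    exact ((S.toFun s).le_opNorm _).trans (by gcongr; exact hM s hs)
  have hsub' : ∀ s t, 0 ≤ s → 0 ≤ t →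
      ‖S.toFun t x - S.toFun s x‖ ≤ M * ‖S.toFun |t - s| x - x‖ := by
    intro s t hs ht
    rcases le_total s t with h | h
    · exact hsub s t hs h
    · rw [norm_sub_rev, abs_sub_comm]
      exact hsub t s ht h
  intro s hs
  refine tendsto_iff_norm_sub_tendsto_zero.2 ?_
  have h1 : Tendsto (fun t : ℝ => |t - s|) (𝓝[Ici 0] s) (𝓝[Ici 0] 0) := by
    refine tendsto_nhdsWithin_iff.2 ⟨?_, Eventually.of_forall fun t => mem_Ici.2 (abs_nonneg (t - s))⟩
    have : Continuous fun t : ℝ => |t - s| := by fun_prop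
    have h2 := this.tendsto s
    simp only [sub_self, abs_zero] at h2
    exact h2.mono_left nhdsWithin_le_nhds
  have h2 : Tendsto (fun t : ℝ => M * ‖S.toFun |t - s| x - x‖) (𝓝[Ici 0] s) (𝓝 0) := by
    have h3 := (h0.tendsto.comp h1).sub_const x
    simp only [S.map_zero, ContinuousLinearMap.id_apply, sub_self] at h3
    simpa using h3.norm.const_mul M
  refine squeeze_zero' (Eventually.of_forall fun t => norm_nonneg _) ?_ h2
  filter_upwards [self_mem_nhdsWithin] with t ht using hsub' s t hs ht

theorem C0Semigroup.continuous_orbit (hM : ∀ t, 0 ≤ t → ‖S.toFun t‖ ≤ M) (x : X) :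
    Continuous fun t => S.toFun (max t 0) x :=
  (C0Semigroup.continuousOn_orbit hM x).comp_continuous (by fun_prop) fun t => le_max_right t 0

theorem C0Semigroup.hasDerivWithinAt_orbit {x y : X}
    (hxy : Tendsto (fun h : ℝ => (h : ℂ)⁻¹ • (S.toFun h x - x)) (𝓝[>] 0) (𝓝 y)) {t : ℝ}
    (ht : 0 ≤ t) : HasDerivWithinAt (fun t => S.toFun t x) (S.toFun t y) (Ici t) t := by
  rw [← hasDerivWithinAt_Ioi_iff_Ici, hasDerivWithinAt_iff_tendsto_slope' (by simp)]
  have h1 : Tendsto (fun s : ℝ => s - t) (𝓝[>] t) (𝓝[>] 0) := by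
    refine tendsto_nhdsWithin_iff.2 ⟨?_, ?_⟩
    · have : Continuous fun s : ℝ => s - t := by fun_prop
      have h2 := this.tendsto t
      simp only [sub_self] at h2
      exact h2.mono_left nhdsWithin_le_nhds
    · filter_upwards [self_mem_nhdsWithin] with s hs
      exact mem_Ioi.2 (sub_pos.2 (mem_Ioi.1 hs))
  refine (((S.toFun t).continuous.tendsto y).comp (hxy.comp h1)).congr' ?_
  filter_upwards [self_mem_nhdsWithin] with s hs
  have h2 := S.map_add t (s - t) ht (sub_nonneg.2 (le_of_lt hs))
  rw [add_sub_cancel] at h2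
  rw [slope_def_module, h2]
  simp only [Function.comp_apply, ContinuousLinearMap.comp_apply, map_smul, map_sub]
  rw [← Complex.ofReal_inv, Complex.coe_smul]

-- The inverse is the Laplace transform `x ↦ ∫₀^∞ z⁻¹ e^{-s/z} S(s)x ds`. The bound concerns whole
-- orbits rather than the norm of `J`, so that it can be iterated without collecting a factor `M` at
-- each application.
open MeasureTheory in
theorem IsInfinitesimalGenerator.exists_isInverseOneSub [CompleteSpace X] {A : X →ₗ.[ℂ] X}
    (hA : IsInfinitesimalGenerator A S) (hM : ∀ t, 0 ≤ t → ‖S.toFun t‖ ≤ M) {z : ℂ}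
    (hz : 0 < z.re) :
    ∃ J : X →L[ℂ] X, IsInverseOneSub A z J ∧ ∀ (x : X) (B : ℝ),
      (∀ t, 0 ≤ t → ‖S.toFun t x‖ ≤ B) → ∀ t, 0 ≤ t → ‖S.toFun t (J x)‖ ≤ ‖z‖ / z.re * B := by
  have hz0 : z ≠ 0 := fun h => by simp [h] at hz
  have hc : ∀ x, Continuous fun t => S.toFun (max t 0) x := C0Semigroup.continuous_orbit hM
  have hb : ∀ x t, ‖S.toFun (max t 0) x‖ ≤ M * ‖x‖ := fun x t =>
    (S.toFun _).le_of_opNorm_le (hM _ (le_max_right t 0)) x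
  have hi := fun x => integrableOn_laplaceShift hz (hc x) (hb x) 0 0
  let J₀ : X →ₗ[ℂ] X :=
    { toFun := fun x => laplaceShift z (fun t => S.toFun (max t 0) x) 0
      map_add' := fun x y => by
        simp only [laplaceShift, map_add, smul_add]
        exact integral_add (hi x) (hi y)
      map_smul' := fun c x => by
        simp only [laplaceShift, map_smul, RingHom.id_apply]
        rw [← integral_smul]
        congr 1
        ext s
        rw [smul_comm] }
  let J : X →L[ℂ] X := J₀.mkContinuous (‖z‖ / z.re * M) fun x => by
    rw [mul_assoc]
    exact norm_laplaceShift_le hz fun t _ => hb x t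
  have hJ : ∀ x, J x = laplaceShift z (fun t => S.toFun (max t 0) x) 0 := fun x => rfl
  have hSJ : ∀ x t, 0 ≤ t → S.toFun t (J x) = laplaceShift z (fun t => S.toFun (max t 0) x) t := by
    intro x t ht
    rw [hJ, laplaceShift, ← ContinuousLinearMap.integral_comp_comm _ (hi x)]
    refine setIntegral_congr_fun measurableSet_Ioi fun y hy => ?_
    have hy' : 0 ≤ y := le_of_lt hy
    simp only [map_smul, zero_add]
    rw [max_eq_left hy', max_eq_left (add_nonneg ht hy'), S.map_add t y ht hy']
    rfl
  have hgraph : ∀ x, (J x, z⁻¹ • (J x - x)) ∈ A.graph := by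
    intro x
    rw [hA]
    have h1 := hasDerivAt_laplaceShift hz (hc x) (hb x) 0
    rw [hasDerivAt_iff_tendsto_slope_zero] at h1
    simp only [zero_add, max_self, S.map_zero, ContinuousLinearMap.id_apply, ← hJ] at h1
    refine (h1.mono_left (nhdsWithin_mono 0 fun h hh => ne_of_gt hh)).congr' ?_
    filter_upwards [self_mem_nhdsWithin] with h hh
    rw [hSJ x h (le_of_lt hh), ← Complex.ofReal_inv, Complex.coe_smul]
  have hdom : ∀ x, ∃ hx : J x ∈ A.domain, J x - z • A ⟨J x, hx⟩ = x := by
    intro x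
    obtain ⟨y, hy, hy'⟩ := (LinearPMap.mem_graph_iff _).1 (hgraph x)
    simp only at hy hy'
    refine ⟨hy ▸ y.2, ?_⟩
    have : (⟨J x, hy ▸ y.2⟩ : A.domain) = y := Subtype.ext hy.symm
    rw [this, hy', smul_smul, mul_inv_cancel₀ hz0, one_smul]
    abel
  refine ⟨J, ⟨hdom, fun x => ?_⟩, fun x B hB t ht => ?_⟩
  -- Left inverse: the difference `v` of two preimages satisfies `v = z A v`, so its orbit is a
  -- bounded solution of `e = z e'` and vanishes.
  · obtain ⟨hy, hye⟩ := hdom ((x : X) - z • A x)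
    set y : A.domain := ⟨J ((x : X) - z • A x), hy⟩ with hydef
    have hv : z • A (y - x) = ((y - x : A.domain) : X) := by
      rw [LinearPMap.map_sub, smul_sub, Submodule.coe_sub]
      have : (y : X) - z • A y = x - z • A x := hye
      rw [sub_eq_sub_iff_add_eq_add] at this ⊢
      rw [add_comm, ← this]
    have hgr := (hA _ _).1 (A.mem_graph (y - x))
    have h0 := eqOn_zero_of_sub_smul_deriv hz
      (C0Semigroup.continuousOn_orbit hM ((y - x : A.domain) : X))
      (fun t ht => C0Semigroup.hasDerivWithinAt_orbit hgr ht) (b := M * ‖((y - x : A.domain) : X)‖)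
      (fun t ht => (S.toFun t).le_of_opNorm_le (hM t ht) _)
      (fun t ht => by rw [← map_smul, hv]) 0 le_rfl
    rw [S.map_zero, ContinuousLinearMap.id_apply, Submodule.coe_sub] at h0
    exact sub_eq_zero.1 h0
  · rw [hSJ x t ht]
    refine norm_laplaceShift_le hz fun s hs => ?_
    rw [max_eq_left (ht.trans hs)]
    exact hB s (ht.trans hs)

theorem IsInfinitesimalGenerator.isInverseOneSub_invOneSub [CompleteSpace X] {A : X →ₗ.[ℂ] X}
    (hA : IsInfinitesimalGenerator A S) (hM : ∀ t, 0 ≤ t → ‖S.toFun t‖ ≤ M) {z : ℂ}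
    (hz : 0 < z.re) : IsInverseOneSub A z (invOneSub A z) := by
  obtain ⟨J, hJ, -⟩ := hA.exists_isInverseOneSub hM hz
  rwa [invOneSub_eq hJ]

theorem IsInfinitesimalGenerator.norm_invOneSub_pow_le [CompleteSpace X] {A : X →ₗ.[ℂ] X}
    (hA : IsInfinitesimalGenerator A S) (hM : ∀ t, 0 ≤ t → ‖S.toFun t‖ ≤ M) {z : ℂ}
    (hz : 0 < z.re) (m : ℕ) : ‖invOneSub A z ^ m‖ ≤ (‖z‖ / z.re) ^ m * M := by
  obtain ⟨J, hJ, hJB⟩ := hA.exists_isInverseOneSub hM hz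
  rw [invOneSub_eq hJ]
  have hM0 : 0 ≤ M := (norm_nonneg _).trans (hM 0 le_rfl)
  refine ContinuousLinearMap.opNorm_le_bound _ (by positivity) fun x => ?_
  have key : ∀ t, 0 ≤ t → ‖S.toFun t ((J ^ m) x)‖ ≤ (‖z‖ / z.re) ^ m * (M * ‖x‖) := by
    induction m with
    | zero => intro t ht; simpa using (S.toFun t).le_of_opNorm_le (hM t ht) x
    | succ m ih =>
      intro t ht
      rw [pow_succ', pow_succ', mul_assoc]
      exact hJB _ _ ih t ht
  simpa [S.map_zero, mul_assoc] using key 0 le_rfl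

end Semigroup

/-! ### Taylor coefficients of `(1 - w z)^{-i}` -/

/-- The `k`-th Taylor coefficient at `0` of `(1 - w z)^{-i}`. -/
def resolventCoeff (w : ℂ) (i k : ℕ) : ℂ := (Nat.multichoose i k : ℂ) * w ^ k

/-- The `k`-th Taylor coefficient at `0` of `z (1 - w z)^{-i}`. -/
def mulResolventCoeff (w : ℂ) (i : ℕ) : ℕ → ℂ
  | 0 => 0
  | k + 1 => resolventCoeff w i k

section Coefficients

variable (w : ℂ)

@[simp]
theorem resolventCoeff_zero_right (i : ℕ) : resolventCoeff w i 0 = 1 := by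
  simp [resolventCoeff]

@[simp]
theorem resolventCoeff_zero_succ (k : ℕ) : resolventCoeff w 0 (k + 1) = 0 := by
  simp [resolventCoeff]

/-- Coefficient form of `(1 - w z) (1 - w z)^{-(i+1)} = (1 - w z)^{-i}`; every later induction on
the exponent rests on it. -/
theorem resolventCoeff_succ_succ (i k : ℕ) : resolventCoeff w (i + 1) (k + 1) =
    resolventCoeff w i (k + 1) + w * resolventCoeff w (i + 1) k := by
  simp only [resolventCoeff, Nat.multichoose_succ_succ]
  push_cast
  ring

theorem mul_mulResolventCoeff (i k : ℕ) : w * mulResolventCoeff w (i + 1) k =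
    resolventCoeff w (i + 1) k - resolventCoeff w i k := by
  cases k with
  | zero => simp [mulResolventCoeff]
  | succ k => rw [resolventCoeff_succ_succ, mulResolventCoeff]; ring

theorem succ_mul_multichoose (i k : ℕ) :
    (k + 1) * Nat.multichoose i (k + 1) = i * Nat.multichoose (i + 1) k := by
  cases i with
  | zero => simp
  | succ i =>
    rw [Nat.multichoose_eq, Nat.multichoose_eq]
    have h1 : i + 1 + (k + 1) - 1 = i + k + 1 := by omega
    have h2 : i + 1 + 1 + k - 1 = i + k + 1 := by omega
    rw [h1, h2, mul_comm, ← Nat.succ_eq_add_one k, Nat.choose_succ_right_eq, mul_comm]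
    congr 1
    omega

theorem eventually_one_sub_mul_ne_zero : ∀ᶠ z : ℂ in 𝓝 0, 1 - w * z ≠ 0 := by
  have : ContinuousAt (fun z : ℂ => 1 - w * z) 0 := by fun_prop
  exact this.eventually_ne (by simp)

theorem iteratedDeriv_inv_one_sub_pow (i k : ℕ) :
    iteratedDeriv k (fun z : ℂ => ((1 - w * z) ^ i)⁻¹) 0 = k.factorial * resolventCoeff w i k := by
  induction k generalizing i with
  | zero => simp
  | succ k ih =>
    have hd : deriv (fun z : ℂ => ((1 - w * z) ^ i)⁻¹) =ᶠ[𝓝 0]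
        fun z => (i * w) * ((1 - w * z) ^ (i + 1))⁻¹ := by
      filter_upwards [eventually_one_sub_mul_ne_zero w] with z hz
      have h1 : HasDerivAt (fun z : ℂ => 1 - w * z) (-(w * 1)) z :=
        ((hasDerivAt_id z).const_mul w).const_sub 1
      have h2 := (h1.fun_pow i).fun_inv (pow_ne_zero i hz)
      rw [h2.deriv]
      cases i with
      | zero => simp
      | succ i =>
        simp only [Nat.add_sub_cancel]
        field_simp
        ring
    rw [iteratedDeriv_succ', hd.iteratedDeriv_eq, iteratedDeriv_const_mul_field, ih,
      resolventCoeff, resolventCoeff, Nat.factorial_succ]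
    have := congrArg (Nat.cast (R := ℂ)) (succ_mul_multichoose i k)
    push_cast at this ⊢
    linear_combination (-(w ^ (k + 1) * (k.factorial : ℂ))) * this

theorem iteratedDeriv_mul_inv_one_sub_pow (hw : w ≠ 0) (i k : ℕ) :
    iteratedDeriv k (fun z : ℂ => z * ((1 - w * z) ^ (i + 1))⁻¹) 0 =
      k.factorial * mulResolventCoeff w (i + 1) k := by
  have h1 : (fun z : ℂ => w * (z * ((1 - w * z) ^ (i + 1))⁻¹)) =ᶠ[𝓝 0]
      (fun z => ((1 - w * z) ^ (i + 1))⁻¹) - fun z => ((1 - w * z) ^ i)⁻¹ := by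
    filter_upwards [eventually_one_sub_mul_ne_zero w] with z hz
    simp only [Pi.sub_apply]
    field_simp
    ring
  have hsm : ∀ j, ContDiffAt ℂ k (fun z : ℂ => ((1 - w * z) ^ j)⁻¹) 0 := fun j =>
    ContDiffAt.inv (by fun_prop) (by simp)
  have h2 := h1.iteratedDeriv_eq k
  rw [iteratedDeriv_const_mul_field, iteratedDeriv_sub (hsm _) (hsm _),
    iteratedDeriv_inv_one_sub_pow, iteratedDeriv_inv_one_sub_pow, ← mul_sub,
    ← mul_mulResolventCoeff, mul_left_comm] at h2
  exact mul_left_cancel₀ hw h2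

theorem inv_one_sub_pow_sub_sum_isBigO (i q : ℕ) :
    (fun z : ℂ => ((1 - w * z) ^ i)⁻¹ - ∑ k ∈ Finset.range (q + 1), resolventCoeff w i k * z ^ k)
      =O[𝓝 0] fun z => z ^ (q + 1) := by
  induction i with
  | zero => simpa [Finset.sum_range_succ'] using isBigO_zero _ _
  | succ i ih =>
    have h1 : (fun z : ℂ => (1 - w * z)⁻¹) =O[𝓝 0] fun _ => (1 : ℂ) := by
      have : ContinuousAt (fun z : ℂ => (1 - w * z)⁻¹) 0 :=
        ContinuousAt.inv₀ (by fun_prop) (by simp)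
      exact this.isBigO_one ℂ
    have h2 := h1.mul (ih.add (isBigO_const_mul_self (w * resolventCoeff w (i + 1) q)
      (fun z : ℂ => z ^ (q + 1)) (𝓝 0)))
    simp only [one_mul] at h2
    refine IsBigO.congr' h2 ?_ EventuallyEq.rfl
    filter_upwards [eventually_one_sub_mul_ne_zero w] with z hz
    have h3 : (1 - w * z) * ∑ k ∈ Finset.range (q + 1), resolventCoeff w (i + 1) k * z ^ k =
        ∑ k ∈ Finset.range (q + 1), resolventCoeff w i k * z ^ k -
          w * resolventCoeff w (i + 1) q * z ^ (q + 1) := by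
      clear ih h1 h2
      induction q with
      | zero => simp
      | succ q ihq =>
        rw [Finset.sum_range_succ, mul_add, ihq, Finset.sum_range_succ _ (q + 1),
          resolventCoeff_succ_succ]
        ring
    rw [inv_mul_eq_iff_eq_mul₀ hz, mul_sub, h3, pow_succ]
    field_simp
    ring

theorem coeff_eq_zero_of_isBigO {n : ℕ} {a : ℕ → ℂ}
    (h : (fun z : ℂ => ∑ k ∈ Finset.range n, a k * z ^ k) =O[𝓝[≠] 0] fun z => z ^ n) :
    ∀ k < n, a k = 0 := by
  induction n generalizing a with
  | zero => intro k hk; omega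
  | succ n ih =>
    have ha0 : a 0 = 0 := by
      have h1 : Tendsto (fun z : ℂ => ∑ k ∈ Finset.range (n + 1), a k * z ^ k) (𝓝[≠] 0)
          (𝓝 (a 0)) := by
        have hc : Continuous fun z : ℂ => ∑ k ∈ Finset.range (n + 1), a k * z ^ k := by fun_prop
        have := hc.tendsto 0
        simp only [Finset.sum_range_succ', pow_zero, mul_one] at this
        simp only [Finset.sum_range_succ', pow_zero, mul_one]
        refine Tendsto.mono_left ?_ nhdsWithin_le_nhds
        simpa using this
      have h2 : Tendsto (fun z : ℂ => z ^ (n + 1)) (𝓝[≠] 0) (𝓝 0) := by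
        have hc : Continuous fun z : ℂ => z ^ (n + 1) := by fun_prop
        have := hc.tendsto 0
        simp only [ne_eq, Nat.add_eq_zero_iff, one_ne_zero, and_false, not_false_eq_true,
          zero_pow] at this
        exact this.mono_left nhdsWithin_le_nhds
      exact tendsto_nhds_unique h1 (h.trans_tendsto h2)
    have h3 : (fun z : ℂ => ∑ k ∈ Finset.range n, a (k + 1) * z ^ k) =O[𝓝[≠] 0]
        fun z => z ^ n := by
      have h4 := (isBigO_refl (fun z : ℂ => z⁻¹) (𝓝[≠] 0)).mul h
      refine h4.congr' ?_ ?_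
      · filter_upwards [self_mem_nhdsWithin] with z hz
        have hz : z ≠ 0 := hz
        rw [Finset.sum_range_succ', ha0, zero_mul, add_zero, Finset.mul_sum]
        refine Finset.sum_congr rfl fun k _ => ?_
        rw [pow_succ]
        field_simp
      · filter_upwards [self_mem_nhdsWithin] with z hz
        have hz : z ≠ 0 := hz
        rw [pow_succ]
        field_simp
    intro k hk
    cases k with
    | zero => exact ha0
    | succ k => exact ih h3 k (by omega)

end Coefficients

/-! ### Moment conditions of the weights and order conditions of `r`. -/

section SimpleFractions

variable {r : SimpleFractions}

theorem SimpleFractions.w_ne_zero (l : Fin r.k) : r.w l ≠ 0 := fun h => by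
  have := r.re_w_pos l
  simp [h] at this

theorem sum_gammaWeights {q : ℕ} {c : Fin q → ℝ} (hc : Function.Injective c) (l : Fin r.k) (i : ℕ)
    {k : ℕ} (hk : k < q) :
    ∑ s, (c s : ℂ) ^ k * gammaWeights r c l i s =
      k.factorial * resolventCoeff (r.w l) i k := by
  have := vandermondeWeights_spec (fun z => ((1 - r.w l * z) ^ i)⁻¹) hc ⟨k, hk⟩
  rwa [iteratedDeriv_inv_one_sub_pow] at this

theorem sum_etaWeights {q : ℕ} {d : Fin q → ℝ} (hd : Function.Injective d) (l : Fin r.k) (i : ℕ)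
    {k : ℕ} (hk : k < q) :
    ∑ s, (d s : ℂ) ^ k * etaWeights r d l (i + 1) s =
      k.factorial * mulResolventCoeff (r.w l) (i + 1) k := by
  have := vandermondeWeights_spec (fun z => z * ((1 - r.w l * z) ^ (i + 1))⁻¹) hd ⟨k, hk⟩
  rwa [iteratedDeriv_mul_inv_one_sub_pow _ (SimpleFractions.w_ne_zero l)] at this

theorem SimpleFractions.HasOrder.sum_coeff {p : ℕ} (h : r.HasOrder p) {k : ℕ} (hk : k ≤ p) :
    (if k = 0 then r.rInf else 0) + ∑ l, ∑ j ∈ Finset.Icc 1 (r.m l),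
      r.coeff l j * resolventCoeff (r.w l) j k = (k.factorial : ℂ)⁻¹ := by
  set a : ℕ → ℂ := fun k => (if k = 0 then r.rInf else 0) + ∑ l, ∑ j ∈ Finset.Icc 1 (r.m l),
      r.coeff l j * resolventCoeff (r.w l) j k with ha
  have h1 : (fun z : ℂ => r.eval z - ∑ k ∈ Finset.range (p + 1), a k * z ^ k) =O[𝓝 0]
      fun z => z ^ (p + 1) := by
    have h2 : (fun z : ℂ => ∑ l, ∑ j ∈ Finset.Icc 1 (r.m l), r.coeff l j *
        (((1 - r.w l * z) ^ j)⁻¹ - ∑ k ∈ Finset.range (p + 1), resolventCoeff (r.w l) j k * z ^ k))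
        =O[𝓝 0] fun z => z ^ (p + 1) :=
      IsBigO.fun_sum fun l _ => IsBigO.fun_sum fun j _ =>
        (inv_one_sub_pow_sub_sum_isBigO (r.w l) j p).const_mul_left _
    refine h2.congr_left fun z => ?_
    have h3 : ∑ k ∈ Finset.range (p + 1), a k * z ^ k = r.rInf + ∑ l, ∑ j ∈ Finset.Icc 1 (r.m l),
        r.coeff l j * ∑ k ∈ Finset.range (p + 1), resolventCoeff (r.w l) j k * z ^ k := by
      simp only [ha, add_mul, Finset.sum_add_distrib, ite_mul, zero_mul]
      congr 1
      · simp
      · simp only [Finset.sum_mul, Finset.mul_sum]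
        rw [Finset.sum_comm]
        refine Finset.sum_congr rfl fun l _ => ?_
        rw [Finset.sum_comm]
        simp only [mul_assoc]
    rw [h3, SimpleFractions.eval, add_sub_add_left_eq_sub]
    simp only [mul_sub, Finset.sum_sub_distrib, div_eq_mul_inv, mul_comm z]
  have h5 := coeff_eq_zero_of_isBigO (n := p + 1) (a := fun k => a k - (k.factorial : ℂ)⁻¹) <| by
    have h6 := (((h.add (Complex.exp_sub_sum_range_isBigO_pow (p + 1))).sub h1).mono
      (nhdsWithin_le_nhds (s := {0}ᶜ)))
    refine h6.congr_left fun z => ?_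
    simp only [sub_mul, Finset.sum_sub_distrib, div_eq_mul_inv, mul_comm (z ^ _)]
    ring
  exact sub_eq_zero.1 (h5 k (by omega))

/-- Without poles `r` would be constant, while its linear coefficient must be `1`. The pole is
needed for the lower bound on the node constants. -/
theorem SimpleFractions.HasOrder.exists_one_le_m {p : ℕ} (hp : 1 ≤ p) (h : r.HasOrder p) :
    ∃ l, 1 ≤ r.m l := by
  by_contra! hm
  have := h.sum_coeff hp
  rw [Finset.sum_eq_zero fun l _ => by
    rw [Finset.Icc_eq_empty (by have := hm l; omega), Finset.sum_empty]] at this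
  simp at this

end SimpleFractions

/-! ### Expansion of the resolvents of the translation semigroup -/

/-- With `b (k + 1)` in the role of `B b_k`, this applies `1 - τ w B` to the truncated series of `(1
- τ w B)^{-(i+1)}`. The result is the truncated series of `(1 - τ w B)^{-i}`, up to one leftover
term from the cut at `q`. -/
theorem sum_resolventCoeff_succ {E : Type*} [AddCommGroup E] [Module ℂ E] (w τ : ℂ) (i q : ℕ)
    (b : ℕ → E) :
    ∑ k ∈ Finset.range (q + 1), (resolventCoeff w (i + 1) k * τ ^ k) • b k -
        (τ * w) • ∑ k ∈ Finset.range (q + 1), (resolventCoeff w (i + 1) k * τ ^ k) • b (k + 1) =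
      ∑ k ∈ Finset.range (q + 1), (resolventCoeff w i k * τ ^ k) • b k -
        (w * resolventCoeff w (i + 1) q * τ ^ (q + 1)) • b (q + 1) := by
  induction q with
  | zero => simp [mul_comm]
  | succ q ih =>
    rw [Finset.sum_range_succ, Finset.sum_range_succ _ (q + 1), Finset.sum_range_succ _ (q + 1),
      smul_add, add_sub_add_comm, ih, resolventCoeff_succ_succ]
    module

theorem re_ofReal_mul_pos {τ : ℝ} (hτ : 0 < τ) {w : ℂ} (hw : 0 < w.re) : 0 < ((τ : ℂ) * w).re := by
  rw [Complex.re_ofReal_mul]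
  positivity

theorem norm_div_re_ofReal_mul {τ : ℝ} (hτ : 0 < τ) (w : ℂ) :
    ‖(τ : ℂ) * w‖ / ((τ : ℂ) * w).re = ‖w‖ / w.re := by
  rw [Complex.re_ofReal_mul, norm_mul, Complex.norm_real, Real.norm_of_nonneg hτ.le,
    mul_div_mul_left _ _ hτ.ne']

/-- The constant in the expansion of `(1 - τ w B)^{-i}` up to order `q`. -/
def expansionConst (w : ℂ) (q : ℕ) : ℕ → ℝ
  | 0 => 0
  | i + 1 => ‖w‖ / w.re * (expansionConst w q i + ‖w * resolventCoeff w (i + 1) q‖)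

theorem expansionConst_nonneg {w : ℂ} (hw : 0 < w.re) (q i : ℕ) : 0 ≤ expansionConst w q i := by
  induction i with
  | zero => exact le_rfl
  | succ i ih => rw [expansionConst]; positivity

theorem IsCub.exists_bound {n : ℕ} {h : ℝ → ℂ} (hh : IsCub n h) {j : ℕ} (hj : j ≤ n) :
    ∃ b : ℝ, ∀ s ∈ Ici (0 : ℝ), ‖iteratedDerivWithin j h (Ici 0) s‖ ≤ b :=
  (hh.2 j hj).1

theorem IsCub.hasDerivWithinAt {φ : ℝ → ℂ} (h : IsCub 1 φ) {s : ℝ} (hs : 0 ≤ s) :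
    HasDerivWithinAt φ (derivWithin φ (Ici 0) s) (Ici 0) s :=
  ((h.1.differentiableOn (by simp)) s hs).hasDerivWithinAt

section Expansion

variable {τ : ℝ} {w : ℂ} {ψ φ : ℝ → ℂ} {q i : ℕ} {G : ℕ → ℝ → ℂ} {B : ℝ}

/-- The error `e` at exponent `i + 1` solves `e - τ w e' =` (error at exponent `i`) + (leftover term
of order `τ^(q+1)`). The bound for this equation then yields the recursion defining
`expansionConst`. -/
theorem IsShiftResolventPow.norm_sub_expansion_le (hτ : 0 < τ) (hw : 0 < w.re)
    (h : IsShiftResolventPow τ w ψ i φ) (hG : IsJet (q + 1) (Ici 0) G)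
    (hψ : ∀ s, 0 ≤ s → ψ s = G 0 s) (hb : ∀ k ≤ q, ∃ b, ∀ s, 0 ≤ s → ‖G k s‖ ≤ b)
    (hB : ∀ s, 0 ≤ s → ‖G (q + 1) s‖ ≤ B) : ∀ s, 0 ≤ s →
    ‖φ s - ∑ k ∈ Finset.range (q + 1), (resolventCoeff w i k * (τ : ℂ) ^ k) • G k s‖ ≤
      expansionConst w q i * (τ ^ (q + 1) * B) := by
  induction i generalizing φ with
  | zero =>
    intro s hs
    rw [h s hs, hψ s hs]
    simp [Finset.sum_range_succ', expansionConst]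
  | succ i ih =>
    obtain ⟨χ, hχ, hφ, heq⟩ := h
    have hz := re_ofReal_mul_pos hτ hw
    have hd : ∀ s, 0 ≤ s → HasDerivWithinAt (fun s => φ s - ∑ k ∈ Finset.range (q + 1),
        (resolventCoeff w (i + 1) k * (τ : ℂ) ^ k) • G k s) (derivWithin φ (Ici 0) s -
        ∑ k ∈ Finset.range (q + 1), (resolventCoeff w (i + 1) k * (τ : ℂ) ^ k) • G (k + 1) s)
        (Ici 0) s := fun s hs => by
      refine (hφ.hasDerivWithinAt hs).sub (HasDerivWithinAt.fun_sum fun k hk => ?_)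
      exact (hG k (Finset.mem_range.1 hk) s hs).const_smul
        (resolventCoeff w (i + 1) k * (τ : ℂ) ^ k)
    obtain ⟨bφ, hbφ⟩ := hφ.exists_bound (j := 0) (by omega)
    choose! b hb using hb
    rw [expansionConst, mul_assoc, ← norm_div_re_ofReal_mul hτ w]
    refine norm_le_of_sub_smul_deriv hz (fun s hs => (hd s hs).continuousWithinAt)
      (fun s hs => (hd s hs).mono (Ici_subset_Ici.2 hs))
      (b := bφ + ∑ k ∈ Finset.range (q + 1), ‖resolventCoeff w (i + 1) k * (τ : ℂ) ^ k‖ * b k)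
      (fun s hs => ?_) fun s hs => ?_
    · refine (norm_sub_le _ _).trans (add_le_add (by simpa using hbφ s hs) ?_)
      refine (norm_sum_le _ _).trans (Finset.sum_le_sum fun k hk => ?_)
      rw [norm_smul]
      gcongr
      exact hb k (by have := Finset.mem_range.1 hk; omega) s hs
    · have h1 : φ s - ∑ k ∈ Finset.range (q + 1),
          (resolventCoeff w (i + 1) k * (τ : ℂ) ^ k) • G k s - ((τ : ℂ) * w) •
          (derivWithin φ (Ici 0) s - ∑ k ∈ Finset.range (q + 1),
            (resolventCoeff w (i + 1) k * (τ : ℂ) ^ k) • G (k + 1) s) =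
          (χ s - ∑ k ∈ Finset.range (q + 1), (resolventCoeff w i k * (τ : ℂ) ^ k) • G k s) +
          (w * resolventCoeff w (i + 1) q * (τ : ℂ) ^ (q + 1)) • G (q + 1) s := by
        have h2 := sum_resolventCoeff_succ w τ i q fun k => G k s
        have h3 := heq s hs
        rw [← h3, smul_sub, smul_eq_mul _ (derivWithin φ (Ici 0) s)]
        linear_combination -h2
      rw [h1]
      refine (norm_add_le _ _).trans ?_
      rw [add_mul]
      refine add_le_add (ih hχ s hs) ?_
      rw [norm_smul, norm_mul, norm_pow, Complex.norm_real, Real.norm_of_nonneg hτ.le, mul_assoc]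
      gcongr
      exact hB s hs

/-- The equation reads `τ w φ' = φ - χ`, so the expansion of `τ φ'` is a difference of two known
expansions divided by `w`. -/
theorem IsShiftResolventPow.norm_deriv_sub_expansion_le (hτ : 0 < τ) (hw : 0 < w.re)
    (h : IsShiftResolventPow τ w ψ (i + 1) φ) (hG : IsJet (q + 1) (Ici 0) G)
    (hψ : ∀ s, 0 ≤ s → ψ s = G 0 s) (hb : ∀ k ≤ q, ∃ b, ∀ s, 0 ≤ s → ‖G k s‖ ≤ b)
    (hB : ∀ s, 0 ≤ s → ‖G (q + 1) s‖ ≤ B) :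
    ‖τ * derivWithin φ (Ici 0) 0 -
      ∑ k ∈ Finset.range (q + 1), (mulResolventCoeff w (i + 1) k * (τ : ℂ) ^ k) • G k 0‖ ≤
      (expansionConst w q (i + 1) + expansionConst w q i) / ‖w‖ * (τ ^ (q + 1) * B) := by
  obtain ⟨χ, hχ, hφ, heq⟩ := id h
  have h1 := h.norm_sub_expansion_le hτ hw hG hψ hb hB 0 le_rfl
  have h2 := hχ.norm_sub_expansion_le hτ hw hG hψ hb hB 0 le_rfl
  have hw0 : 0 < ‖w‖ := norm_pos_iff.2 fun h => by simp [h] at hw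
  rw [div_mul_eq_mul_div, le_div_iff₀ hw0, mul_comm, ← norm_mul, add_mul]
  refine le_trans (le_of_eq ?_) ((norm_sub_le _ _).trans (add_le_add h1 h2))
  congr 1
  have h3 := heq 0 (mem_Ici.2 le_rfl)
  have h4 : w * ∑ k ∈ Finset.range (q + 1), (mulResolventCoeff w (i + 1) k * (τ : ℂ) ^ k) • G k 0 =
      ∑ k ∈ Finset.range (q + 1), (resolventCoeff w (i + 1) k * (τ : ℂ) ^ k) • G k 0 -
      ∑ k ∈ Finset.range (q + 1), (resolventCoeff w i k * (τ : ℂ) ^ k) • G k 0 := by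
    rw [Finset.mul_sum, ← Finset.sum_sub_distrib]
    refine Finset.sum_congr rfl fun k _ => ?_
    simp only [smul_eq_mul]
    linear_combination (τ : ℂ) ^ k * G k 0 * mul_mulResolventCoeff w i k
  rw [mul_sub, h4]
  linear_combination -h3

/-- `IsNodeConst` only speaks of a given resolvent power `φ`; existence of `φ` is what makes it
usable. -/
theorem exists_isShiftResolventPow (hτ : 0 < τ) (hw : 0 < w.re)
    (hb : ∃ b : ℝ, ∀ s ∈ Ici (0 : ℝ), ‖ψ s‖ ≤ b) (hu : UniformContinuousOn ψ (Ici 0)) (i : ℕ) :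
    ∃ φ, IsShiftResolventPow τ w ψ i φ ∧ (∃ b : ℝ, ∀ s ∈ Ici (0 : ℝ), ‖φ s‖ ≤ b) ∧
      UniformContinuousOn φ (Ici 0) := by
  induction i with
  | zero => exact ⟨ψ, fun _ _ => rfl, hb, hu⟩
  | succ i ih =>
    obtain ⟨χ, hχ, ⟨b, hb⟩, hu⟩ := ih
    have hz := re_ofReal_mul_pos hτ hw
    set z := (τ : ℂ) * w with hzdef
    have hz0 : z ≠ 0 := fun h => by simp [h] at hz
    set G : ℝ → ℂ := fun s => χ (max s 0) with hGdef
    have hG : Continuous G := hu.continuousOn.comp_continuous (by fun_prop) fun s =>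
      le_max_right s 0
    have hGb : ∀ s, ‖G s‖ ≤ b := fun s => hb _ (le_max_right s 0)
    have hGχ : ∀ s ∈ Ici (0 : ℝ), G s = χ s := fun s hs => by
      simp only [hGdef, max_eq_left (mem_Ici.1 hs)]
    have hd := hasDerivAt_laplaceShift hz hG hGb
    set φ := laplaceShift z G with hφ
    have hφb : ∀ s, ‖φ s‖ ≤ ‖z‖ / z.re * b := fun s => norm_laplaceShift_le hz fun x _ => hGb x
    have hdw : ∀ s ∈ Ici (0 : ℝ), derivWithin φ (Ici 0) s = z⁻¹ • (φ s - G s) := fun s hs =>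
      (hd s).hasDerivWithinAt.derivWithin (uniqueDiffOn_Ici 0 s hs)
    have hdb : ∀ s, ‖z⁻¹ • (φ s - G s)‖ ≤ ‖z⁻¹‖ * (‖z‖ / z.re * b + b) := fun s => by
      rw [norm_smul]
      gcongr
      exact (norm_sub_le _ _).trans (add_le_add (hφb s) (hGb s))
    have hφu : UniformContinuousOn φ (Ici 0) :=
      uniformContinuousOn_of_hasDerivWithinAt (fun x _ => (hd x).hasDerivWithinAt)
        fun x _ => hdb x
    have hφc : Continuous φ := continuous_iff_continuousAt.2 fun s => (hd s).continuousAt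
    have hCD : ContDiff ℝ 1 φ := by
      rw [contDiff_one_iff_deriv]
      refine ⟨fun s => (hd s).differentiableAt, ?_⟩
      rw [funext fun s => (hd s).deriv]
      fun_prop
    refine ⟨φ, ⟨χ, hχ, ⟨hCD.contDiffOn, fun j hj => ?_⟩, fun s hs => ?_⟩, ⟨_, fun s _ => hφb s⟩, hφu⟩
    · interval_cases j
      · simp only [iteratedDerivWithin_zero]
        exact ⟨⟨_, fun s _ => hφb s⟩, hφu⟩
      · simp only [iteratedDerivWithin_one]
        refine ⟨⟨_, fun s hs => by rw [hdw s hs]; exact hdb s⟩, ?_⟩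
        have h1 : UniformContinuousOn (fun s => z⁻¹ • (φ s - χ s)) (Ici 0) := by
          rw [uniformContinuousOn_iff_restrict] at hφu hu ⊢
          exact (hφu.sub hu).const_smul z⁻¹
        exact h1.congr fun s hs => by rw [hdw s hs, hGχ s hs]
    · rw [hdw s hs, hGχ s hs, smul_eq_mul, mul_inv_cancel_left₀ hz0]
      ring

end Expansion

/-! ### Finiteness of the node constants -/

/-- The moment conditions say that the weights reproduce the functional `∑ σ_k τ^k H_k(t)` on
polynomials of degree below `n`, so only Taylor remainders at the nodes survive. -/
theorem norm_quadrature_sub_le {q n : ℕ} {H : ℕ → ℝ → ℂ} (hH : IsJet n (Ici 0) H) {B τ t : ℝ}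
    (hB : ∀ s, 0 ≤ s → ‖H n s‖ ≤ B) (hτ : 0 < τ) (ht : 0 ≤ t) {c : Fin q → ℝ} {γ : Fin q → ℂ}
    {σ : ℕ → ℂ} (hγ : ∀ k < n, ∑ s, (c s : ℂ) ^ k * γ s = k.factorial * σ k)
    (hc : ∀ s, 0 ≤ t + τ * c s) :
    ‖∑ k ∈ Finset.range n, (σ k * (τ : ℂ) ^ k) • H k t - ∑ s, γ s * H 0 (t + τ * c s)‖ ≤
      (∑ s, ‖γ s‖ * |c s| ^ n) * (τ ^ n * B) := by
  have h1 : ∑ k ∈ Finset.range n, (σ k * (τ : ℂ) ^ k) • H k t =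
      ∑ s, γ s * ∑ k ∈ Finset.range n, (((t + τ * c s) - t) ^ k / (k.factorial : ℝ)) • H k t := by
    simp only [Finset.mul_sum]
    rw [Finset.sum_comm]
    refine Finset.sum_congr rfl fun k hk => ?_
    have h2 : σ k = (k.factorial : ℂ)⁻¹ * ∑ s, (c s : ℂ) ^ k * γ s := by
      rw [hγ k (Finset.mem_range.1 hk), inv_mul_cancel_left₀]
      exact_mod_cast k.factorial_ne_zero
    rw [h2, Finset.mul_sum, Finset.sum_mul, Finset.sum_smul]
    refine Finset.sum_congr rfl fun s _ => ?_
    rw [Complex.real_smul, smul_eq_mul, add_sub_cancel_left]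
    push_cast
    rw [mul_pow]
    ring
  rw [h1, ← Finset.sum_sub_distrib, Finset.sum_mul]
  refine (norm_sum_le _ _).trans (Finset.sum_le_sum fun s _ => ?_)
  rw [← mul_sub, norm_mul, norm_sub_rev, mul_assoc]
  refine mul_le_mul_of_nonneg_left ?_ (norm_nonneg _)
  have h3 := hH.taylor (mem_Ici.2 ht) (mem_Ici.2 (hc s)) hB
  rw [add_sub_cancel_left, abs_mul, abs_of_pos hτ, mul_pow] at h3
  rw [add_sub_cancel_left]
  calc _ ≤ _ := h3
    _ = _ := by ring

theorem IsCub.isJet {n : ℕ} {h : ℝ → ℂ} (hh : IsCub n h) :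
    IsJet n (Ici 0) fun k => iteratedDerivWithin k h (Ici 0) :=
  hh.1.isJet (uniqueDiffOn_Ici 0)

theorem IsCub.le_iSup {n : ℕ} {h : ℝ → ℂ} (hh : IsCub n h) {s : ℝ} (hs : 0 ≤ s) :
    ‖iteratedDerivWithin n h (Ici 0) s‖ ≤
      ⨆ x : Ici (0 : ℝ), ‖iteratedDerivWithin n h (Ici 0) (x : ℝ)‖ := by
  obtain ⟨b, hb⟩ := hh.exists_bound le_rfl
  exact le_ciSup (f := fun x : Ici (0 : ℝ) => ‖iteratedDerivWithin n h (Ici 0) (x : ℝ)‖)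
    ⟨b, by rintro _ ⟨x, rfl⟩; exact hb x x.2⟩ ⟨s, hs⟩

theorem IsJet.comp_const_add {E : Type*} [NormedAddCommGroup E] [NormedSpace ℝ E] {n : ℕ}
    {H : ℕ → ℝ → E} (hH : IsJet n (Ici 0) H) {t : ℝ} (ht : 0 ≤ t) :
    IsJet n (Ici 0) fun k x => H k (t + x) := by
  intro k hk x hx
  have hmaps : MapsTo (fun x => t + x) (Ici (0 : ℝ)) (Ici 0) := fun y hy =>
    mem_Ici.2 (add_nonneg ht hy)
  have h1 := (hH k hk (t + x) (hmaps hx)).scomp x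
    ((hasDerivAt_id x).const_add t).hasDerivWithinAt hmaps
  simpa [Function.comp_def] using h1

theorem nodeConst_lt_top {r : SimpleFractions} {p : ℕ} (hp : 1 ≤ p) {c : Fin p → ℝ}
    {d : Fin (p + 1) → ℝ} (hc : Function.Injective c) (hd : Function.Injective d) :
    nodeConst r c d < ⊤ := by
  obtain ⟨q, rfl⟩ : ∃ q, p = q + 1 := ⟨p - 1, by omega⟩
  have hC : ∀ l q i, 0 ≤ expansionConst (r.w l) q i := fun l => expansionConst_nonneg (r.re_w_pos l)
  -- The first group serves the inequality for `γ`, the second the one for `η`. Each adds the error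
  -- of the resolvent expansion to that of the quadrature.
  set a : (l : Fin r.k) → ℕ → ℝ := fun l i =>
    (expansionConst (r.w l) q i + ∑ s, ‖gammaWeights r c l i s‖ * |c s| ^ (q + 1)) +
    ((expansionConst (r.w l) (q + 1) i + expansionConst (r.w l) (q + 1) (i - 1)) / ‖r.w l‖ +
      ∑ s, ‖etaWeights r d l i s‖ * |d s| ^ (q + 1 + 1)) with ha
  have ha1 : ∀ l i, 0 ≤ expansionConst (r.w l) q i +
      ∑ s, ‖gammaWeights r c l i s‖ * |c s| ^ (q + 1) := fun l i => by
    have := hC l q i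
    positivity
  have ha2 : ∀ l i, 0 ≤ (expansionConst (r.w l) (q + 1) i +
      expansionConst (r.w l) (q + 1) (i - 1)) / ‖r.w l‖ +
      ∑ s, ‖etaWeights r d l i s‖ * |d s| ^ (q + 1 + 1) := fun l i => by
    have := hC l (q + 1) i
    have := hC l (q + 1) (i - 1)
    positivity
  have ha0 : ∀ l i, 0 ≤ a l i := fun l i => add_nonneg (ha1 l i) (ha2 l i)
  set κ : ℝ := ∑ l, ∑ i ∈ Finset.Icc 1 (r.m l), a l i with hκ
  have hκ0 : 0 ≤ κ := Finset.sum_nonneg fun l _ => Finset.sum_nonneg fun i _ => ha0 l i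
  have hle : ∀ l, ∀ i ∈ Finset.Icc 1 (r.m l), a l i ≤ κ := fun l i hi =>
    (Finset.single_le_sum (f := fun i => a l i) (fun i _ => ha0 l i) hi).trans
      (Finset.single_le_sum (f := fun l => ∑ i ∈ Finset.Icc 1 (r.m l), a l i)
        (fun l _ => Finset.sum_nonneg fun i _ => ha0 l i) (Finset.mem_univ l))
  have hnode : IsNodeConst r c d κ.toNNReal := by
    intro τ hτ l i hi t ht
    refine ⟨fun hct h φ hh hφ => ?_, fun hdt h φ hh hφ => ?_⟩
    · set B := ⨆ x : Ici (0 : ℝ), ‖iteratedDerivWithin (q + 1) h (Ici 0) (x : ℝ)‖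
      have hB : ∀ s, 0 ≤ s → ‖iteratedDerivWithin (q + 1) h (Ici 0) s‖ ≤ B := fun s hs =>
        hh.le_iSup hs
      have hB0 := (norm_nonneg _).trans (hB 0 le_rfl)
      have h1 := hφ.norm_sub_expansion_le hτ (r.re_w_pos l) (hh.isJet.comp_const_add ht)
        (fun s _ => by simp) (fun k hk => by
          obtain ⟨b, hb⟩ := hh.exists_bound (j := k) (by omega)
          exact ⟨b, fun s hs => hb _ (add_nonneg ht hs)⟩)
        (fun s hs => hB _ (add_nonneg ht hs)) 0 le_rfl
      have h2 := norm_quadrature_sub_le hh.isJet hB hτ ht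
        (fun k hk => sum_gammaWeights hc l i hk) hct
      simp only [add_zero, iteratedDerivWithin_zero] at h1 h2
      refine (norm_sub_le_norm_sub_add_norm_sub _ _ _).trans ((add_le_add h1 h2).trans ?_)
      rw [← add_mul, Real.coe_toNNReal κ hκ0, mul_assoc]
      refine mul_le_mul_of_nonneg_right ((le_add_of_nonneg_right (ha2 l i)).trans (hle l i hi)) ?_
      positivity
    · obtain ⟨j, rfl⟩ : ∃ j, i = j + 1 := ⟨i - 1, by have := (Finset.mem_Icc.1 hi).1; omega⟩
      set B := ⨆ x : Ici (0 : ℝ), ‖iteratedDerivWithin (q + 1 + 1) h (Ici 0) (x : ℝ)‖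
      have hB : ∀ s, 0 ≤ s → ‖iteratedDerivWithin (q + 1 + 1) h (Ici 0) s‖ ≤ B := fun s hs =>
        hh.le_iSup hs
      have hB0 := (norm_nonneg _).trans (hB 0 le_rfl)
      have h1 := hφ.norm_deriv_sub_expansion_le hτ (r.re_w_pos l) (hh.isJet.comp_const_add ht)
        (fun s _ => by simp) (fun k hk => by
          obtain ⟨b, hb⟩ := hh.exists_bound (j := k) (by omega)
          exact ⟨b, fun s hs => hb _ (add_nonneg ht hs)⟩)
        (fun s hs => hB _ (add_nonneg ht hs))
      have h2 := norm_quadrature_sub_le hh.isJet hB hτ ht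
        (fun k hk => sum_etaWeights hd l j hk) hdt
      simp only [add_zero, iteratedDerivWithin_zero] at h1 h2
      refine (norm_sub_le_norm_sub_add_norm_sub _ _ _).trans ((add_le_add h1 h2).trans ?_)
      rw [← add_mul, Real.coe_toNNReal κ hκ0, mul_assoc]
      refine mul_le_mul_of_nonneg_right ((le_add_of_nonneg_left (ha1 l (j + 1))).trans
        (hle l (j + 1) hi)) ?_
      positivity
  exact (iInf₂_le _ hnode).trans_lt ENNReal.coe_lt_top

/-- The infimum of the admissible constants is itself admissible, since each defining inequality is
closed in `κ`. Thus the supremum over all steps serves every step. -/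
theorem isNodeConst_toNNReal {r : SimpleFractions} {p : ℕ} {c : Fin p → ℝ}
    {d : Fin (p + 1) → ℝ} {K : ℝ≥0∞} (hK : K ≠ ⊤) (h : nodeConst r c d ≤ K) :
    IsNodeConst r c d K.toNNReal := by
  have key : ∀ {x y : ℝ}, 0 ≤ y → (∀ κ : ℝ≥0, IsNodeConst r c d κ → x ≤ κ * y) →
      x ≤ K.toNNReal * y := by
    intro x y hy hx
    refine le_of_forall_gt_imp_ge_of_dense fun b hb => ?_
    rcases hy.eq_or_lt with rfl | hy
    -- When the right-hand factor vanishes, any admissible constant will do, and finiteness of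
    -- `nodeConst` supplies one.
    · have hne : ∃ κ : ℝ≥0, IsNodeConst r c d κ := by
        by_contra! hne
        have : nodeConst r c d = ⊤ := by simp [nodeConst, hne]
        exact hK (top_le_iff.1 (this ▸ h))
      obtain ⟨κ, hκ⟩ := hne
      have := hx κ hκ
      simp only [mul_zero] at this hb
      linarith
    · have hb' : (K.toNNReal : ℝ) < b / y := (lt_div_iff₀ hy).2 hb
      have hlt : nodeConst r c d < ENNReal.ofReal (b / y) := by
        refine h.trans_lt ?_
        rw [← ENNReal.coe_toNNReal hK, ENNReal.lt_ofReal_iff_toReal_lt ENNReal.coe_ne_top]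
        exact hb'
      obtain ⟨κ, hκ⟩ := iInf_lt_iff.1 hlt
      obtain ⟨hκ, hκlt⟩ := iInf_lt_iff.1 hκ
      have h1 : (κ : ℝ) < b / y := by
        rwa [ENNReal.lt_ofReal_iff_toReal_lt ENNReal.coe_ne_top] at hκlt
      have := (lt_div_iff₀ hy).1 h1
      linarith [hx κ hκ]
  intro τ hτ l i hi t ht
  refine ⟨fun hct h φ hh hφ => ?_, fun hdt h φ hh hφ => ?_⟩
  · rw [mul_assoc]
    refine key (mul_nonneg (by positivity) (Real.iSup_nonneg fun _ => norm_nonneg _)) fun κ hκ => ?_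
    rw [← mul_assoc]
    exact (hκ τ hτ l i hi t ht).1 hct h φ hh hφ
  · rw [mul_assoc]
    refine key (mul_nonneg (by positivity) (Real.iSup_nonneg fun _ => norm_nonneg _)) fun κ hκ => ?_
    rw [← mul_assoc]
    exact (hκ τ hτ l i hi t ht).2 hdt h φ hh hφ

/-! ### Extension of jets from a bounded interval -/

theorem HasDerivWithinAt.ite_le {E : Type*} [NormedAddCommGroup E] [NormedSpace ℝ E] {T x : ℝ}
    {f g : ℝ → E} {f' g' : E} (hfg : f T = g T)
    (hf : x ≤ T → HasDerivWithinAt f f' (Ici 0) x) (hg : T ≤ x → HasDerivWithinAt g g' (Ici T) x)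
    (hfg' : x = T → f' = g') :
    HasDerivWithinAt (fun y => if y ≤ T then f y else g y) (if x ≤ T then f' else g') (Ici 0) x := by
  have hle : ∀ y ∈ Ici T, (if y ≤ T then f y else g y) = g y := fun y hy => by
    split_ifs with h
    · rw [le_antisymm h hy, hfg]
    · rfl
  have h1 : HasDerivWithinAt (fun y => if y ≤ T then f y else g y) (if x ≤ T then f' else g')
      (Icc 0 T) x := by
    by_cases hx : x ≤ T
    · rw [if_pos hx]
      exact ((hf hx).mono Icc_subset_Ici_self).congr_of_eventuallyEq
        (eventually_of_mem self_mem_nhdsWithin fun y hy => if_pos hy.2) (if_pos hx)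
    · refine HasFDerivWithinAt.of_notMem_closure fun h => hx ?_
      rw [isClosed_Icc.closure_eq] at h
      exact h.2
  have h2 : HasDerivWithinAt (fun y => if y ≤ T then f y else g y) (if x ≤ T then f' else g')
      (Ici T) x := by
    by_cases hx : T ≤ x
    · have hd : (if x ≤ T then f' else g') = g' := by
        split_ifs with h
        · exact hfg' (le_antisymm h hx)
        · rfl
      rw [hd]
      exact (hg hx).congr hle (hle x hx)
    · refine HasFDerivWithinAt.of_notMem_closure fun h => hx ?_
      rwa [isClosed_Ici.closure_eq] at h
  refine (h1.union h2).mono fun y hy => ?_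
  rcases le_total y T with h | h
  · exact Or.inl ⟨hy, h⟩
  · exact Or.inr h

/-- Nodes `-1, …, -(n + 1)`: the decay rates of the exponentials used for extensions. -/
def decayRate {n : ℕ} (i : Fin (n + 1)) : ℝ := -((i : ℝ) + 1)

/-- Matching `n + 1` derivatives by `n + 1` exponentials with distinct rates is a Vandermonde
system; `D` comes from the entries of its inverse and depends only on `n`. -/
theorem exists_exponential_jet (n : ℕ) : ∃ D : ℝ, 0 ≤ D ∧ ∀ (b : Fin (n + 1) → ℂ) (N : ℝ),
    (∀ k, ‖b k‖ ≤ N) → ∃ a : Fin (n + 1) → ℂ, (∀ i, ‖a i‖ ≤ D * N) ∧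
      ∀ k : Fin (n + 1), ∑ i, (decayRate i ^ (k : ℕ)) • a i = b k := by
  set V := (Matrix.vandermonde fun i : Fin (n + 1) => (decayRate i : ℂ)).transpose with hV
  have hdet : IsUnit V.det := by
    rw [hV, Matrix.det_transpose, isUnit_iff_ne_zero, Matrix.det_vandermonde_ne_zero_iff]
    intro i j hij
    have : decayRate i = decayRate j := Complex.ofReal_injective hij
    simp only [decayRate, neg_inj, add_left_inj, Nat.cast_inj] at this
    exact Fin.ext this
  refine ⟨∑ i, ∑ k, ‖V⁻¹ i k‖, by positivity, fun b N hb => ⟨V⁻¹.mulVec b, fun i => ?_, fun k => ?_⟩⟩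
  · have hN : 0 ≤ N := (norm_nonneg _).trans (hb 0)
    calc ‖V⁻¹.mulVec b i‖ = ‖∑ k, V⁻¹ i k * b k‖ := rfl
      _ ≤ ∑ k, ‖V⁻¹ i k * b k‖ := norm_sum_le _ _
      _ ≤ ∑ k, ‖V⁻¹ i k‖ * N := Finset.sum_le_sum fun k _ => by
          rw [norm_mul]
          exact mul_le_mul_of_nonneg_left (hb k) (norm_nonneg _)
      _ = (∑ k, ‖V⁻¹ i k‖) * N := by rw [Finset.sum_mul]
      _ ≤ _ := by
          refine mul_le_mul_of_nonneg_right ?_ hN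
          exact Finset.single_le_sum (f := fun i => ∑ k, ‖V⁻¹ i k‖)
            (fun i _ => by positivity) (Finset.mem_univ i)
  · have h : V.mulVec (V⁻¹.mulVec b) = b := by
      rw [Matrix.mulVec_mulVec, Matrix.mul_nonsing_inv _ hdet, Matrix.one_mulVec]
    have := congrFun h k
    rw [← this]
    simp [Matrix.mulVec, dotProduct, hV, Matrix.vandermonde_apply]

theorem exists_jet_extension (n : ℕ) : ∃ C : ℝ, 0 ≤ C ∧ ∀ (T N : ℝ) (H : ℕ → ℝ → ℂ), 0 ≤ T →
    IsJet n (Ici 0) H → (∀ k ≤ n, ∀ s ∈ Icc 0 T, ‖H k s‖ ≤ N) →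
    ∃ H' : ℕ → ℝ → ℂ, IsJet n (Ici 0) H' ∧ (∀ k, ∀ s ∈ Icc 0 T, H' k s = H k s) ∧
      ∀ k ≤ n, ∀ s, 0 ≤ s → ‖H' k s‖ ≤ C * N := by
  obtain ⟨D, hD, hV⟩ := exists_exponential_jet n
  -- The product bounds the exponential tail: `n + 1` terms, with rates of modulus at most `n + 1`.
  -- The summand `1` covers `[0,T]`, where the jet is unchanged. Centring the exponentials at `T`
  -- makes the constant independent of `T`.
  refine ⟨(n + 1) * ((n + 1) ^ n * D) + 1, by positivity, fun T N H hT hH hN => ?_⟩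
  have hN0 : 0 ≤ N := (norm_nonneg _).trans (hN 0 (by omega) 0 ⟨le_rfl, hT⟩)
  obtain ⟨a, ha, hab⟩ := hV (fun k => H k T) N fun k => hN k (by omega) T ⟨hT, le_rfl⟩
  set Q : ℕ → ℝ → ℂ := fun k x => ∑ i, (decayRate i ^ k * Real.exp (decayRate i * (x - T))) • a i
  have hQT : ∀ k ≤ n, H k T = Q k T := fun k hk => by
    simp only [Q, sub_self, mul_zero, Real.exp_zero, mul_one]
    exact (hab ⟨k, by omega⟩).symm
  have hQd : ∀ k x, HasDerivAt (Q k) (Q (k + 1) x) x := fun k x => by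
    refine HasDerivAt.fun_sum fun i _ => ?_
    have h1 := ((((hasDerivAt_id x).sub_const T).const_mul (decayRate i)).exp.const_mul
      (decayRate i ^ k)).smul_const (a i)
    refine h1.congr_deriv ?_
    congr 1
    simp only [id]
    ring
  have hQb : ∀ k ≤ n, ∀ x, T ≤ x → ‖Q k x‖ ≤ (n + 1) * ((n + 1) ^ n * D) * N := fun k hk x hx => by
    refine (norm_sum_le_of_le (f := fun i =>
      (decayRate i ^ k * Real.exp (decayRate i * (x - T))) • a i)
      (n := fun _ => (n + 1 : ℝ) ^ n * (D * N)) _ fun i _ => ?_).trans_eq ?_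
    · rw [norm_smul, norm_mul, norm_pow, Real.norm_of_nonneg (Real.exp_pos _).le]
      have h1 : ‖decayRate i‖ ≤ (n : ℝ) + 1 := by
        rw [decayRate, norm_neg, Real.norm_of_nonneg (by positivity)]
        gcongr
        exact_mod_cast Nat.lt_succ_iff.1 i.2
      have h2 : Real.exp (decayRate i * (x - T)) ≤ 1 := by
        rw [Real.exp_le_one_iff, decayRate, neg_mul, neg_nonpos]
        exact mul_nonneg (by positivity) (sub_nonneg.2 hx)
      have h3 : ‖decayRate i‖ ^ k ≤ ((n : ℝ) + 1) ^ n :=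
        (pow_le_pow_left₀ (norm_nonneg _) h1 k).trans
          (pow_le_pow_right₀ (by linarith [Nat.cast_nonneg (α := ℝ) n]) hk)
      calc ‖decayRate i‖ ^ k * Real.exp (decayRate i * (x - T)) * ‖a i‖
          ≤ ((n : ℝ) + 1) ^ n * 1 * (D * N) := by
            gcongr
            exact ha i
        _ = _ := by ring
    · simp
      ring
  refine ⟨fun k x => if x ≤ T then H k x else Q k x, fun k hk x hx => ?_, fun k s hs => if_pos hs.2,
    fun k hk s hs => ?_⟩
  · refine HasDerivWithinAt.ite_le (hQT k hk.le) (fun _ => hH k hk x hx)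
      (fun _ => (hQd k x).hasDerivWithinAt) ?_
    rintro rfl
    exact hQT (k + 1) hk
  · simp only
    split_ifs with h
    · have h1 := hN k hk s ⟨hs, h⟩
      have h2 : 0 ≤ (n + 1) * ((n + 1) ^ n * D) * N := by positivity
      linarith
    · have h1 := hQb k hk s (not_le.1 h).le
      linarith

/-! ### Quadrature errors in terms of the node constant. -/

theorem norm_sum_sub_sum_le_of_scalar {E : Type*} [NormedAddCommGroup E] [NormedSpace ℂ E]
    {n m q : ℕ} {γ : Fin q → ℂ} {x : Fin q → ℝ} {a : ℕ → ℂ} {t T N R : ℝ}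
    (h : ∀ H : ℕ → ℝ → ℂ, IsJet n (Ici 0) H → (∀ k ≤ n, ∀ s ∈ Icc 0 T, ‖H k s‖ ≤ N) →
      ‖∑ s, γ s * H 0 (x s) - ∑ k ∈ Finset.range m, a k * H k t‖ ≤ R)
    {F : ℕ → ℝ → E} (hF : IsJet n (Ici 0) F) (hN : ∀ k ≤ n, ∀ s ∈ Icc 0 T, ‖F k s‖ ≤ N) :
    ‖∑ s, γ s • F 0 (x s) - ∑ k ∈ Finset.range m, a k • F k t‖ ≤ R := by
  -- A functional of norm at most `1` attains the norm of the error, and it commutes with both sums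
  -- and with differentiation.
  obtain ⟨L, hL, hLv⟩ := exists_dual_vector'' ℂ
    (∑ s, γ s • F 0 (x s) - ∑ k ∈ Finset.range m, a k • F k t)
  have h1 := h (fun k y => L (F k y)) (hF.comp_clm (L.restrictScalars ℝ)) fun k hk s hs =>
    (L.le_of_opNorm_le hL _).trans (by simpa using hN k hk s hs)
  have h2 : ∑ s, γ s * L (F 0 (x s)) - ∑ k ∈ Finset.range m, a k * L (F k t) =
      L (∑ s, γ s • F 0 (x s) - ∑ k ∈ Finset.range m, a k • F k t) := by
    simp
  rw [h2, hLv] at h1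
  simpa using h1

/-- The extra bounded derivative yields uniform continuity of the `n`-th one. This is where the data
need one derivative beyond the order of the quadrature estimate. -/
theorem IsJet.isCub_and_exists_resolvent {n : ℕ} {H : ℕ → ℝ → ℂ} {B τ t : ℝ} {w : ℂ}
    (hH : IsJet (n + 1) (Ici 0) H) (hB : ∀ k ≤ n + 1, ∀ s, 0 ≤ s → ‖H k s‖ ≤ B) (hτ : 0 < τ)
    (hw : 0 < w.re) (ht : 0 ≤ t) (i : ℕ) :
    IsCub n (H 0) ∧ (⨆ x : Ici (0 : ℝ), ‖iteratedDerivWithin n (H 0) (Ici 0) (x : ℝ)‖) ≤ B ∧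
      ∃ φ, IsShiftResolventPow τ w (fun x => H 0 (t + x)) i φ := by
  have he := hH.iteratedDerivWithin_eq (uniqueDiffOn_Ici 0)
  refine ⟨hH.isCub fun k hk => ⟨B, fun s hs => hB k hk s hs⟩, ?_, ?_⟩
  · have : Nonempty (Ici (0 : ℝ)) := ⟨⟨0, mem_Ici.2 le_rfl⟩⟩
    refine ciSup_le fun x => ?_
    rw [he n (by omega) x x.2]
    exact hB n (by omega) x x.2
  · obtain ⟨φ, hφ, -⟩ := exists_isShiftResolventPow (ψ := fun x => H 0 (t + x)) hτ hw
      ⟨B, fun s hs => hB 0 (by omega) _ (add_nonneg ht hs)⟩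
      (uniformContinuousOn_of_hasDerivWithinAt (fun x hx => hH.comp_const_add ht 0 (by omega) x hx)
        fun x hx => hB 1 (by omega) _ (add_nonneg ht hx)) i
    exact ⟨φ, hφ⟩

/-- The resolvent value `φ 0` is inserted between point values and Taylor sum: the weights then
appear only through `κ`, never through their size. -/
theorem exists_gamma_quadrature_bound (r : SimpleFractions) (q : ℕ) (l : Fin r.k) (i : ℕ) :
    ∃ C : ℝ, 0 ≤ C ∧ ∀ (c : Fin (q + 1) → ℝ) (d : Fin (q + 1 + 1) → ℝ) (κ : ℝ≥0),
      IsNodeConst r c d κ → i ∈ Finset.Icc 1 (r.m l) → ∀ (τ t T N : ℝ), 0 < τ → 0 ≤ t → t ≤ T →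
      (∀ s, 0 ≤ t + τ * c s) → (∀ s, t + τ * c s ≤ T) → ∀ H : ℕ → ℝ → ℂ,
      IsJet (q + 2) (Ici 0) H → (∀ k ≤ q + 2, ∀ s ∈ Icc 0 T, ‖H k s‖ ≤ N) →
      ‖∑ s, gammaWeights r c l i s * H 0 (t + τ * c s) -
        ∑ k ∈ Finset.range (q + 2), resolventCoeff (r.w l) i k * (τ : ℂ) ^ k * H k t‖ ≤
      C * (1 + κ) * (τ ^ (q + 1) * N) := by
  obtain ⟨C₀, hC₀, hext⟩ := exists_jet_extension (q + 2)
  have he0 := expansionConst_nonneg (r.re_w_pos l) q i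
  set E := expansionConst (r.w l) q i
  set R := ‖resolventCoeff (r.w l) i (q + 1)‖ with hR
  -- `C₀` multiplies `κ` (point values against `φ 0`), `E * C₀` is the expansion of `φ 0` up to
  -- order `q`, and `R` accounts for the additional Taylor term of index `q + 1`.
  refine ⟨C₀ + E * C₀ + R, by positivity, ?_⟩
  intro c d κ hκ hi τ t T N hτ ht htT hc hcT H hH hN
  have hN0 : 0 ≤ N := (norm_nonneg _).trans (hN 0 (by omega) t ⟨ht, htT⟩)
  obtain ⟨G, hG, hGH, hGN⟩ := hext T N H (ht.trans htT) hH hN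
  obtain ⟨hcub, hsup, φ, hφ⟩ := IsJet.isCub_and_exists_resolvent (n := q + 1) hG hGN hτ
    (r.re_w_pos l) ht i
  have h1 := (hκ τ hτ l i hi t ht).1 hc _ φ hcub hφ
  have h2 := hφ.norm_sub_expansion_le (q := q) hτ (r.re_w_pos l)
    ((hG.mono (by omega)).comp_const_add ht) (fun s _ => rfl)
    (fun k hk => ⟨C₀ * N, fun s hs => hGN k (by omega) _ (add_nonneg ht hs)⟩)
    (fun s hs => hGN (q + 1) (by omega) _ (add_nonneg ht hs)) 0 le_rfl
  simp only [add_zero, smul_eq_mul] at h2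
  have h3 : ‖resolventCoeff (r.w l) i (q + 1) * (τ : ℂ) ^ (q + 1) * H (q + 1) t‖ ≤
      R * (τ ^ (q + 1) * N) := by
    rw [norm_mul, norm_mul, norm_pow, Complex.norm_real, Real.norm_of_nonneg hτ.le, mul_assoc]
    gcongr
    exact hN (q + 1) (by omega) t ⟨ht, htT⟩
  have h4 : ∀ s, H 0 (t + τ * c s) = G 0 (t + τ * c s) := fun s => (hGH 0 _ ⟨hc s, hcT s⟩).symm
  rw [Finset.sum_range_succ]
  simp only [h4]
  set a := ∑ s, gammaWeights r c l i s * G 0 (t + τ * c s)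
  set b := ∑ k ∈ Finset.range (q + 1), resolventCoeff (r.w l) i k * (τ : ℂ) ^ k * G k t
  have hb : ∑ k ∈ Finset.range (q + 1), resolventCoeff (r.w l) i k * (τ : ℂ) ^ k * H k t = b :=
    Finset.sum_congr rfl fun k _ => by rw [hGH k t ⟨ht, htT⟩]
  have h5 : a - (b + resolventCoeff (r.w l) i (q + 1) * (τ : ℂ) ^ (q + 1) * H (q + 1) t) =
      -(φ 0 - a) + (φ 0 - b) - resolventCoeff (r.w l) i (q + 1) * (τ : ℂ) ^ (q + 1) * H (q + 1) t := by
    ring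
  rw [hb, h5]
  refine (norm_sub_le _ _).trans ((add_le_add ((norm_add_le _ _).trans (add_le_add
    ((norm_neg _).trans_le h1) h2)) h3).trans ?_)
  have h6 : κ * τ ^ (q + 1) * (⨆ x : Ici (0 : ℝ),
      ‖iteratedDerivWithin (q + 1) (G 0) (Ici 0) (x : ℝ)‖) ≤ κ * τ ^ (q + 1) * (C₀ * N) := by
    gcongr
  have h7 : 0 ≤ (C₀ + E * C₀ * κ + R * κ) * (τ ^ (q + 1) * N) := by positivity
  linarith

theorem exists_eta_quadrature_bound (r : SimpleFractions) (q : ℕ) (l : Fin r.k) (i : ℕ) :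
    ∃ C : ℝ, 0 ≤ C ∧ ∀ (c : Fin q → ℝ) (d : Fin (q + 1) → ℝ) (κ : ℝ≥0),
      IsNodeConst r c d κ → i + 1 ∈ Finset.Icc 1 (r.m l) → ∀ (τ t T N : ℝ), 0 < τ → 0 ≤ t → t ≤ T →
      (∀ s, 0 ≤ t + τ * d s) → (∀ s, t + τ * d s ≤ T) → ∀ H : ℕ → ℝ → ℂ,
      IsJet (q + 2) (Ici 0) H → (∀ k ≤ q + 2, ∀ s ∈ Icc 0 T, ‖H k s‖ ≤ N) →
      ‖∑ s, etaWeights r d l (i + 1) s * H 0 (t + τ * d s) -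
        ∑ k ∈ Finset.range (q + 2), mulResolventCoeff (r.w l) (i + 1) k * (τ : ℂ) ^ k * H k t‖ ≤
      C * (1 + κ) * (τ ^ (q + 1) * N) := by
  obtain ⟨C₀, hC₀, hext⟩ := exists_jet_extension (q + 2)
  set E := (expansionConst (r.w l) q (i + 1) + expansionConst (r.w l) q i) / ‖r.w l‖
  have he0 : 0 ≤ E := div_nonneg (add_nonneg (expansionConst_nonneg (r.re_w_pos l) q (i + 1))
    (expansionConst_nonneg (r.re_w_pos l) q i)) (norm_nonneg _)
  set R := ‖mulResolventCoeff (r.w l) (i + 1) (q + 1)‖ with hR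
  refine ⟨C₀ + E * C₀ + R, by positivity, ?_⟩
  intro c d κ hκ hi τ t T N hτ ht htT hd hdT H hH hN
  have hN0 : 0 ≤ N := (norm_nonneg _).trans (hN 0 (by omega) t ⟨ht, htT⟩)
  obtain ⟨G, hG, hGH, hGN⟩ := hext T N H (ht.trans htT) hH hN
  obtain ⟨hcub, hsup, φ, hφ⟩ := IsJet.isCub_and_exists_resolvent (n := q + 1) hG hGN hτ
    (r.re_w_pos l) ht (i + 1)
  have h1 := (hκ τ hτ l (i + 1) hi t ht).2 hd _ φ hcub hφ
  have h2 := hφ.norm_deriv_sub_expansion_le (q := q) hτ (r.re_w_pos l)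
    ((hG.mono (by omega)).comp_const_add ht) (fun s _ => rfl)
    (fun k hk => ⟨C₀ * N, fun s hs => hGN k (by omega) _ (add_nonneg ht hs)⟩)
    (fun s hs => hGN (q + 1) (by omega) _ (add_nonneg ht hs))
  simp only [add_zero, smul_eq_mul] at h2
  have h3 : ‖mulResolventCoeff (r.w l) (i + 1) (q + 1) * (τ : ℂ) ^ (q + 1) * H (q + 1) t‖ ≤
      R * (τ ^ (q + 1) * N) := by
    rw [norm_mul, norm_mul, norm_pow, Complex.norm_real, Real.norm_of_nonneg hτ.le, mul_assoc]
    gcongr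
    exact hN (q + 1) (by omega) t ⟨ht, htT⟩
  have h4 : ∀ s, H 0 (t + τ * d s) = G 0 (t + τ * d s) := fun s => (hGH 0 _ ⟨hd s, hdT s⟩).symm
  rw [Finset.sum_range_succ]
  simp only [h4]
  set a := ∑ s, etaWeights r d l (i + 1) s * G 0 (t + τ * d s)
  set b := ∑ k ∈ Finset.range (q + 1), mulResolventCoeff (r.w l) (i + 1) k * (τ : ℂ) ^ k * G k t
  have hb : ∑ k ∈ Finset.range (q + 1), mulResolventCoeff (r.w l) (i + 1) k * (τ : ℂ) ^ k * H k t = b :=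
    Finset.sum_congr rfl fun k _ => by rw [hGH k t ⟨ht, htT⟩]
  set y := (τ : ℂ) * derivWithin φ (Ici 0) 0
  have h5 : a - (b + mulResolventCoeff (r.w l) (i + 1) (q + 1) * (τ : ℂ) ^ (q + 1) * H (q + 1) t) =
      -(y - a) + (y - b) -
        mulResolventCoeff (r.w l) (i + 1) (q + 1) * (τ : ℂ) ^ (q + 1) * H (q + 1) t := by
    ring
  rw [hb, h5]
  refine (norm_sub_le _ _).trans ((add_le_add ((norm_add_le _ _).trans (add_le_add
    ((norm_neg _).trans_le h1) h2)) h3).trans ?_)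
  have h6 : κ * τ ^ (q + 1) * (⨆ x : Ici (0 : ℝ),
      ‖iteratedDerivWithin (q + 1) (G 0) (Ici 0) (x : ℝ)‖) ≤ κ * τ ^ (q + 1) * (C₀ * N) := by
    gcongr
  have h7 : 0 ≤ (C₀ + E * C₀ * κ + R * κ) * (τ ^ (q + 1) * N) := by positivity
  linarith

/-! ### A positive lower bound for the node constants -/

theorem iteratedDeriv_eq_zero_of_eventually {F : ℝ → ℂ} {x : ℝ} (h : ∀ᶠ y in 𝓝 x, F y = 0)
    (k : ℕ) : iteratedDeriv k F x = 0 := by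
  have h1 : F =ᶠ[𝓝 x] fun _ => (0 : ℂ) := h
  rw [h1.iteratedDeriv_eq k]
  simp

theorem exists_bound_iteratedDeriv {F : ℝ → ℂ} {a b : ℝ} (hF : ContDiff ℝ (⊤ : ℕ∞) F)
    (hb : ∀ x, b < x → F x = 0) (k : ℕ) : ∃ B : ℝ, ∀ x, a ≤ x → ‖iteratedDeriv k F x‖ ≤ B := by
  obtain ⟨B, hB⟩ := (isCompact_Icc (a := a) (b := b)).exists_bound_of_continuousOn
    (hF.continuous_iteratedDeriv k (by exact_mod_cast le_top)).continuousOn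
  refine ⟨max B 0, fun x hx => ?_⟩
  rcases le_or_gt x b with h | h
  · exact (hB x ⟨hx, h⟩).trans (le_max_left _ _)
  · rw [iteratedDeriv_eq_zero_of_eventually ((eventually_gt_nhds h).mono hb), norm_zero]
    exact le_max_right _ _

theorem ContDiff.isJet_iteratedDeriv {F : ℝ → ℂ} (hF : ContDiff ℝ (⊤ : ℕ∞) F) (n : ℕ) (s : Set ℝ) :
    IsJet n s fun k => iteratedDeriv k F := by
  intro k _ x _
  have := (hF.differentiable_iteratedDeriv k (by exact_mod_cast WithTop.coe_lt_top k) x).hasDerivAt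
  rw [← iteratedDeriv_succ] at this
  exact this.hasDerivWithinAt

theorem ContDiff.isCub {F : ℝ → ℂ} {b : ℝ} (hF : ContDiff ℝ (⊤ : ℕ∞) F)
    (hb : ∀ x, b < x → F x = 0) (n : ℕ) : IsCub n F := by
  have := (hF.isJet_iteratedDeriv (n + 1) (Ici 0)).isCub fun k _ =>
    exists_bound_iteratedDeriv (a := 0) hF hb k
  simpa using this

/-- Pigeonhole: `p` nodes cannot meet `p + 1` disjoint intervals. -/
theorem exists_forall_notMem_Icc {p : ℕ} (c : Fin p → ℝ) :
    ∃ j : Fin (p + 1), ∀ s, c s ∉ Icc (2 * (j : ℝ)) (2 * j + 1) := by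
  by_contra! h
  choose s hs using h
  obtain ⟨i, j, hij, he⟩ := Fintype.exists_ne_map_eq_of_card_lt s (by simp)
  have h1 := hs i
  have h2 := hs j
  rw [he] at h1
  have h3 : (i : ℝ) < j + 1 := by linarith [h1.1, h2.2]
  have h4 : (j : ℝ) < i + 1 := by linarith [h2.1, h1.2]
  have h3' : (i : ℕ) < j + 1 := by exact_mod_cast h3
  have h4' : (j : ℕ) < i + 1 := by exact_mod_cast h4
  exact hij (Fin.ext (by omega))

/-- A smooth function equal to `e^{x/w}` for `x ≤ a` and to `0` for `x ≥ a + 1`. -/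
def cutoffExp (w : ℂ) (a x : ℝ) : ℂ :=
  Complex.exp (w⁻¹ * x) * ((1 - Real.smoothTransition (x - a) : ℝ) : ℂ)

theorem contDiff_cutoffExp (w : ℂ) (a : ℝ) : ContDiff ℝ (⊤ : ℕ∞) (cutoffExp w a) := by
  have h1 : ContDiff ℝ (⊤ : ℕ∞) fun x : ℝ => (x : ℂ) := Complex.ofRealCLM.contDiff
  have h2 : ContDiff ℝ (⊤ : ℕ∞) fun x : ℝ => 1 - Real.smoothTransition (x - a) :=
    contDiff_const.sub (Real.smoothTransition.contDiff.comp (contDiff_id.sub contDiff_const))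
  exact (contDiff_const.mul h1).cexp.mul (Complex.ofRealCLM.contDiff.comp h2)

theorem cutoffExp_of_le (w : ℂ) {a x : ℝ} (h : x ≤ a) : cutoffExp w a x = Complex.exp (w⁻¹ * x) := by
  simp [cutoffExp, Real.smoothTransition.zero_of_nonpos (sub_nonpos.2 h)]

theorem cutoffExp_of_ge (w : ℂ) {a x : ℝ} (h : a + 1 ≤ x) : cutoffExp w a x = 0 := by
  simp [cutoffExp, Real.smoothTransition.one_of_one_le (by linarith : 1 ≤ x - a)]

/-- A function supported in an interval free of nodes is invisible to the quadrature. With `h = φ -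
w φ'`, where `φ` is `e^{x/w}` cut off on that interval, the point values of `h` vanish while the
resolvent value is `φ(0) = 1`. -/
theorem exists_pos_le_of_isNodeConst (r : SimpleFractions) (p : ℕ) {l : Fin r.k} (hl : 1 ≤ r.m l) :
    ∃ κ₀ : ℝ, 0 < κ₀ ∧ ∀ (c : Fin p → ℝ) (d : Fin (p + 1) → ℝ) (κ : ℝ≥0),
      IsNodeConst r c d κ → κ₀ ≤ κ := by
  set w := r.w l
  have hw0 : w ≠ 0 := SimpleFractions.w_ne_zero l
  set G : ℝ → ℝ → ℂ := fun a x => cutoffExp w a x - w * deriv (cutoffExp w a) x with hG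
  have hGs : ∀ a, ContDiff ℝ (⊤ : ℕ∞) (G a) := fun a => by
    have := (contDiff_infty_iff_deriv.1 (contDiff_cutoffExp w a)).2
    exact (contDiff_cutoffExp w a).sub (contDiff_const.mul this)
  have hGge : ∀ a x, a + 1 < x → G a x = 0 := fun a x hx => by
    have h1 : cutoffExp w a =ᶠ[𝓝 x] fun _ => 0 :=
      (eventually_gt_nhds hx).mono fun y hy => cutoffExp_of_ge w (le_of_lt hy)
    simp only [hG, h1.deriv_eq, cutoffExp_of_ge w hx.le, deriv_const, mul_zero, sub_zero]
  have hGlt : ∀ a x, x < a → G a x = 0 := fun a x hx => by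
    have h1 : cutoffExp w a =ᶠ[𝓝 x] fun y => Complex.exp (w⁻¹ * y) :=
      (eventually_lt_nhds hx).mono fun y hy => cutoffExp_of_le w (le_of_lt hy)
    have h2 : HasDerivAt (fun x : ℝ => Complex.exp (w⁻¹ * x)) (Complex.exp (w⁻¹ * x) * (w⁻¹ * 1))
        x := by
      have := ((Complex.ofRealCLM.hasDerivAt (x := x)).const_mul w⁻¹).cexp
      simpa only [Complex.ofRealCLM_apply, Complex.ofReal_one] using this
    simp only [hG, h1.deriv_eq, cutoffExp_of_le w hx.le, h2.deriv]
    field_simp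
    ring
  have hbd : ∀ j : Fin (p + 1), ∃ B : ℝ, ∀ x, ‖iteratedDeriv p (G (2 * (j : ℝ))) x‖ ≤ B := by
    intro j
    obtain ⟨B, hB⟩ := exists_bound_iteratedDeriv (a := 2 * (j : ℝ)) (hGs (2 * (j : ℝ)))
      (hGge (2 * (j : ℝ))) p
    have hB0 := (norm_nonneg _).trans (hB _ le_rfl)
    refine ⟨B, fun x => ?_⟩
    rcases le_or_gt (2 * (j : ℝ)) x with h | h
    · exact hB x h
    · rw [iteratedDeriv_eq_zero_of_eventually ((eventually_lt_nhds h).mono (hGlt _)), norm_zero]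
      exact hB0
  choose B hB using hbd
  have hB0 : ∀ j, 0 ≤ B j := fun j => (norm_nonneg _).trans (hB j 0)
  have hpos : 0 < 1 + ∑ j, B j := by
    have := Finset.sum_nonneg fun j (_ : j ∈ Finset.univ) => hB0 j
    linarith
  -- Summing over all `p + 1` candidate intervals makes the bound independent of the nodes.
  refine ⟨(1 + ∑ j, B j)⁻¹, inv_pos.2 hpos, fun c d κ hκ => ?_⟩
  obtain ⟨j, hj⟩ := exists_forall_notMem_Icc c
  set a : ℝ := 2 * (j : ℝ) with ha
  have ha0 : 0 ≤ a := by positivity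
  -- With `τ = 1`, translation by `T` brings all nodes into the half line, including negative ones.
  set T := ∑ s, |c s| with hT
  have hT0 : 0 ≤ T := by positivity
  have hTc : ∀ s, 0 ≤ T + 1 * c s := fun s => by
    have := Finset.single_le_sum (f := fun s => |c s|) (fun s _ => abs_nonneg _) (Finset.mem_univ s)
    linarith [neg_abs_le (c s)]
  set h : ℝ → ℂ := fun y => G a (y - T) with hh
  have hhs : ContDiff ℝ (⊤ : ℕ∞) h := (hGs a).comp (contDiff_id.sub contDiff_const)
  have hhcub : IsCub p h := hhs.isCub (b := a + 1 + T) (fun x hx => hGge a _ (by linarith)) p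
  have hφ : IsShiftResolventPow 1 w (fun x => h (T + x)) 1 (cutoffExp w a) := by
    refine ⟨_, fun s _ => rfl, (contDiff_cutoffExp w a).isCub (b := a + 1)
      (fun x hx => cutoffExp_of_ge w hx.le) 1, fun s hs => ?_⟩
    have hd : DifferentiableAt ℝ (cutoffExp w a) s :=
      (contDiff_cutoffExp w a).differentiable (by simp) s
    rw [hd.derivWithin (uniqueDiffOn_Ici 0 s hs)]
    simp [hh, hG]
  have key := (hκ 1 one_pos l 1 (Finset.mem_Icc.2 ⟨le_rfl, hl⟩) T hT0).1 hTc h _ hhcub hφ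
  have hz : ∀ s, h (T + 1 * c s) = 0 := fun s => by
    simp only [hh, one_mul, add_sub_cancel_left]
    rcases lt_or_ge (c s) a with h1 | h1
    · exact hGlt a _ h1
    · exact hGge a _ (not_le.1 fun h2 => hj s ⟨h1, h2⟩)
  have hsup : (⨆ x : Ici (0 : ℝ), ‖iteratedDerivWithin p h (Ici 0) (x : ℝ)‖) ≤ 1 + ∑ j, B j := by
    have : Nonempty (Ici (0 : ℝ)) := ⟨⟨0, mem_Ici.2 le_rfl⟩⟩
    refine ciSup_le fun x => ?_
    have h1 := (hhs.isJet_iteratedDeriv p (Ici 0)).iteratedDerivWithin_eq (uniqueDiffOn_Ici 0) p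
      le_rfl x x.2
    simp only [iteratedDeriv_zero] at h1
    rw [h1, hh, iteratedDeriv_comp_sub_const]
    have h2 := Finset.single_le_sum (f := B) (fun j _ => hB0 j) (Finset.mem_univ j)
    linarith [hB j (x - T)]
  rw [Finset.sum_eq_zero fun s _ => by rw [hz s, mul_zero], cutoffExp_of_le w ha0] at key
  simp only [Complex.ofReal_zero, mul_zero, Complex.exp_zero, sub_zero, norm_one, one_pow,
    mul_one] at key
  rw [inv_le_iff_one_le_mul₀ hpos]
  exact key.trans (mul_le_mul_of_nonneg_left hsup κ.2)

/-! ### The norms `cmNorm` -/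

section CmNorm

variable {Z : Type*} [NormedAddCommGroup Z] [NormedSpace ℂ Z]

theorem cmNorm_nonneg (m : ℕ) (T : ℝ) (h : ℝ → Z) : 0 ≤ cmNorm m T h :=
  Real.iSup_nonneg fun _ => Real.iSup_nonneg fun _ => norm_nonneg _

theorem norm_iteratedDerivWithin_le_cmNorm {m : ℕ} {T : ℝ} {h : ℝ → Z}
    (hh : ContDiffOn ℝ m h (Ici 0)) {k : ℕ} (hk : k ≤ m) {s : ℝ} (hs : s ∈ Icc 0 T) :
    ‖iteratedDerivWithin k h (Ici 0) s‖ ≤ cmNorm m T h := by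
  obtain ⟨b, hb⟩ := (isCompact_Icc (a := 0) (b := T)).exists_bound_of_continuousOn
    ((hh.continuousOn_iteratedDerivWithin (m := k) (by exact_mod_cast hk)
      (uniqueDiffOn_Ici 0)).mono Icc_subset_Ici_self)
  have h1 := le_ciSup (f := fun s : Icc (0 : ℝ) T => ‖iteratedDerivWithin k h (Ici 0) (s : ℝ)‖)
    ⟨b, by rintro _ ⟨x, rfl⟩; exact hb x x.2⟩ ⟨s, hs⟩
  refine h1.trans ?_
  exact le_ciSup (f := fun j : Fin (m + 1) => ⨆ s : Icc (0 : ℝ) T,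
    ‖iteratedDerivWithin (j : ℕ) h (Ici 0) (s : ℝ)‖) (Set.finite_range _).bddAbove
    ⟨k, by omega⟩

end CmNorm

/-! ### The local error -/

section LocalError

variable {X Y : Type*} [NormedAddCommGroup X] [NormedSpace ℂ X] [NormedAddCommGroup Y]
  [NormedSpace ℂ Y]

/-- The differentiated equation, with the unbounded operator replaced by its resolvent. -/
theorem IsSolution.resolvent_jet {A : X →ₗ.[ℂ] X} {K : Y →L[ℂ] X} {f : ℝ → X} {g : ℝ → Y}
    {u : ℝ → X} (hsol : IsSolution A K f g u) {z : ℂ} {J : X →L[ℂ] X} (hJ : IsInverseOneSub A z J)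
    {p : ℕ} (hu : ContDiffOn ℝ (p + 1 : ℕ) u (Ici 0)) (hf : ContDiffOn ℝ (p + 1 : ℕ) f (Ici 0))
    (hg : ContDiffOn ℝ (p + 2 : ℕ) g (Ici 0)) :
    ∀ k ≤ p, ∀ s ∈ Ici (0 : ℝ), iteratedDerivWithin k u (Ici 0) s =
      J (iteratedDerivWithin k u (Ici 0) s - z • (iteratedDerivWithin (k + 1) u (Ici 0) s -
        (iteratedDerivWithin k f (Ici 0) s - K (iteratedDerivWithin (k + 1) g (Ici 0) s)))) := by
  have hU := hu.isJet (uniqueDiffOn_Ici 0)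
  have hF := hf.isJet (uniqueDiffOn_Ici 0)
  have hG := hg.isJet (uniqueDiffOn_Ici 0)
  intro k
  induction k with
  | zero =>
    intro _ s hs
    obtain ⟨hus, hd⟩ := hsol s hs
    have h1 := hd.derivWithin (uniqueDiffOn_Ici 0 s hs)
    simp only [iteratedDerivWithin_zero, zero_add, iteratedDerivWithin_one, h1]
    have h2 := hJ.2 ⟨u s, hus⟩
    simp only at h2
    conv_lhs => rw [← h2]
    congr 3
    abel
  | succ k ih =>
    intro hk s hs
    -- Only the bounded operators `J` and `K` are passed through the derivative, so differentiation
    -- never has to be exchanged with `A`.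
    have hd := (J.restrictScalars ℝ).hasFDerivAt.comp_hasDerivWithinAt s
      ((hU k (by omega) s hs).sub (((hU (k + 1) (by omega) s hs).sub
        ((hF k (by omega) s hs).sub ((K.restrictScalars ℝ).hasFDerivAt.comp_hasDerivWithinAt s
          (hG (k + 1) (by omega) s hs)))).const_smul z))
    have h1 := (hd.congr (fun y hy => ih (by omega) y hy)
      (ih (by omega) s hs)).derivWithin (uniqueDiffOn_Ici 0 s hs)
    rw [← iteratedDerivWithin_succ] at h1
    exact h1

/-- The heart of consistency. In passing from `j` to `j + 1` one applies `J` to the identity and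
adds the new forcing term. The relations `h` express that term through the `b k`, and
`sum_resolventCoeff_succ` makes the series match. Every remainder carries `τ^(q+1)` and the single
vector `b (q + 1)`. -/
theorem resolvent_pow_add_sum {J : X →L[ℂ] X} {w τ : ℂ} {q : ℕ} {b e : ℕ → X}
    (h : ∀ k ≤ q, b k = J (b k - (τ * w) • (b (k + 1) - e k))) (j : ℕ) :
    (J ^ j) (b 0) + (τ * w) • ∑ i ∈ Finset.Icc 1 j, (J ^ (j - i + 1))
        (∑ k ∈ Finset.range (q + 1), (resolventCoeff w i k * τ ^ k) • e k) =
      ∑ k ∈ Finset.range (q + 1), (resolventCoeff w j k * τ ^ k) • b k +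
        ∑ i ∈ Finset.Icc 1 j, (w * resolventCoeff w i q * τ ^ (q + 1)) •
          (J ^ (j - i + 1)) (b (q + 1)) := by
  obtain ⟨P, hP⟩ : ∃ P : ℕ → X, ∀ i,
      ∑ k ∈ Finset.range (q + 1), (resolventCoeff w i k * τ ^ k) • e k = P i := ⟨_, fun _ => rfl⟩
  obtain ⟨a, ha⟩ : ∃ a : ℕ → X, ∀ i,
      ∑ k ∈ Finset.range (q + 1), (resolventCoeff w i k * τ ^ k) • b k = a i := ⟨_, fun _ => rfl⟩
  simp only [hP, ha]
  induction j with
  | zero => simp [← ha, Finset.sum_range_succ']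
  | succ j ih =>
    have hpow : ∀ (i : ℕ) (v : X), i ∈ Finset.Icc 1 j →
        (J ^ (j + 1 - i + 1)) v = J ((J ^ (j - i + 1)) v) := fun i v hi => by
      have := (Finset.mem_Icc.1 hi).2
      rw [show j + 1 - i + 1 = (j - i + 1) + 1 by omega, pow_succ']
      rfl
    -- The hypothesis, read as a formula for `J (e k)` in terms of the `b`'s.
    have hJe : ∀ k ≤ q, (τ * w) • J (e k) = (τ * w) • J (b (k + 1)) - J (b k) + b k :=
      fun k hk => by
        have := h k hk
        simp only [map_sub, map_smul, smul_sub] at this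
        linear_combination (norm := module) -this
    have h1 : (τ * w) • J (P (j + 1)) = (τ * w) •
        J (∑ k ∈ Finset.range (q + 1), (resolventCoeff w (j + 1) k * τ ^ k) • b (k + 1)) -
        J (a (j + 1)) + a (j + 1) := by
      simp only [← hP, ← ha, map_sum, map_smul, Finset.smul_sum]
      rw [← Finset.sum_sub_distrib, ← Finset.sum_add_distrib]
      refine Finset.sum_congr rfl fun k hk => ?_
      rw [smul_comm, hJe k (by have := Finset.mem_range.1 hk; omega), smul_add, smul_sub,
        smul_comm (τ * w)]
    have h2 := congrArg J (sum_resolventCoeff_succ w τ j q b)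
    rw [ha, ha, map_sub, map_sub, map_smul, map_smul] at h2
    have h3 := congrArg J ih
    simp only [map_add, map_smul, map_sum (G := X →L[ℂ] X) J (ι := ℕ)] at h3
    have h4 : ∑ i ∈ Finset.Icc 1 j, (J ^ (j + 1 - i + 1)) (P i) =
        ∑ i ∈ Finset.Icc 1 j, J ((J ^ (j - i + 1)) (P i)) :=
      Finset.sum_congr rfl fun i hi => hpow i (P i) hi
    have h5 : ∑ i ∈ Finset.Icc 1 j, (w * resolventCoeff w i q * τ ^ (q + 1)) •
        (J ^ (j + 1 - i + 1)) (b (q + 1)) = ∑ i ∈ Finset.Icc 1 j,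
        (w * resolventCoeff w i q * τ ^ (q + 1)) • J ((J ^ (j - i + 1)) (b (q + 1))) :=
      Finset.sum_congr rfl fun i hi => by rw [hpow i _ hi]
    rw [Finset.sum_Icc_succ_top (by omega), Finset.sum_Icc_succ_top (by omega), h4, h5, pow_succ']
    simp only [Nat.sub_self, zero_add, pow_one]
    change J ((J ^ j) (b 0)) + _ = _
    linear_combination (norm := module) h3 + h1 - h2

/-- Perturbed form of the identity, in which the exact forcing sums are replaced by computed values
`Q i`. -/
theorem norm_resolvent_pow_add_sum_sub_le {J : X →L[ℂ] X} {w τ : ℂ} {q j : ℕ} {b e Q : ℕ → X}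
    (h : ∀ k ≤ q, b k = J (b k - (τ * w) • (b (k + 1) - e k))) {M C R : ℝ} {D : ℕ → ℝ}
    (hJ : ∀ m, ‖J ^ m‖ ≤ C ^ m * M) (hb : ‖τ ^ (q + 1) • b (q + 1)‖ ≤ R)
    (hQ : ∀ i ∈ Finset.Icc 1 j, ‖Q i - τ • ∑ k ∈ Finset.range (q + 1),
      (resolventCoeff w i k * τ ^ k) • e k‖ ≤ D i * R) :
    ‖(J ^ j) (b 0) + w • ∑ i ∈ Finset.Icc 1 j, (J ^ (j - i + 1)) (Q i) -
      ∑ k ∈ Finset.range (q + 1), (resolventCoeff w j k * τ ^ k) • b k‖ ≤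
    (∑ i ∈ Finset.Icc 1 j, ‖w‖ * C ^ (j - i + 1) * (‖resolventCoeff w i q‖ + D i)) * (M * R) := by
  have h1 := resolvent_pow_add_sum h j
  obtain ⟨P, hP⟩ : ∃ P : ℕ → X, ∀ i,
      ∑ k ∈ Finset.range (q + 1), (resolventCoeff w i k * τ ^ k) • e k = P i := ⟨_, fun _ => rfl⟩
  simp only [hP] at h1 hQ
  have h2 : (J ^ j) (b 0) + w • ∑ i ∈ Finset.Icc 1 j, (J ^ (j - i + 1)) (Q i) -
      ∑ k ∈ Finset.range (q + 1), (resolventCoeff w j k * τ ^ k) • b k =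
      ∑ i ∈ Finset.Icc 1 j, w • (J ^ (j - i + 1)) (resolventCoeff w i q • τ ^ (q + 1) • b (q + 1) +
        (Q i - τ • P i)) := by
    rw [← sub_eq_iff_eq_add] at h1
    rw [← h1]
    simp only [map_add, map_sub, map_smul, smul_add, smul_sub, Finset.sum_add_distrib,
      Finset.sum_sub_distrib, Finset.smul_sum, smul_smul, mul_comm τ w, mul_assoc]
    abel
  rw [h2, Finset.sum_mul]
  refine norm_sum_le_of_le _ fun i hi => ?_
  rw [norm_smul]
  have h3 : ‖resolventCoeff w i q • τ ^ (q + 1) • b (q + 1) +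
      (Q i - τ • P i)‖ ≤
      (‖resolventCoeff w i q‖ + D i) * R := by
    refine (norm_add_le _ _).trans ?_
    rw [add_mul, norm_smul]
    exact add_le_add (mul_le_mul_of_nonneg_left hb (norm_nonneg _)) (hQ i hi)
  calc _ ≤ ‖w‖ * ((C ^ (j - i + 1) * M) * ((‖resolventCoeff w i q‖ + D i) * R)) := by
        refine mul_le_mul_of_nonneg_left ?_ (norm_nonneg _)
        exact ((J ^ (j - i + 1)).le_of_opNorm_le (hJ _) _).trans
          (mul_le_mul_of_nonneg_left h3 ((norm_nonneg _).trans (hJ _)))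
    _ = _ := by ring

/-- The induction bounds `T^m e_k` for all `m` at once, so each local error meets one power of `T`
and the stability constant enters once rather than as `C^n`. -/
theorem norm_le_of_stable_recursion {T : X →L[ℂ] X} {C ρ : ℝ} (hT : ∀ m, ‖T ^ m‖ ≤ C) {e : ℕ → X}
    (h0 : e 0 = 0) {n : ℕ} (he : ∀ j < n, ‖e (j + 1) - T (e j)‖ ≤ ρ) : ‖e n‖ ≤ n * (C * ρ) := by
  have key : ∀ k ≤ n, ∀ m, ‖(T ^ m) (e k)‖ ≤ k * (C * ρ) := by
    intro k
    induction k with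
    | zero => intro _ m; simp [h0]
    | succ k ih =>
      intro hk m
      have h1 : (T ^ m) (e (k + 1)) = (T ^ (m + 1)) (e k) + (T ^ m) (e (k + 1) - T (e k)) := by
        rw [map_sub, pow_succ]
        simp
      rw [h1]
      refine (norm_add_le _ _).trans ((add_le_add (ih (by omega) (m + 1))
        (((T ^ m).le_of_opNorm_le (hT m) _).trans (mul_le_mul_of_nonneg_left (he k (by omega))
          ((norm_nonneg _).trans (hT m))))).trans_eq ?_)
      push_cast
      ring
  simpa using key n le_rfl 0

theorem norm_pow_evalOp_le {r : SimpleFractions} {A : X →ₗ.[ℂ] X} (h : stabilityConst r A < ⊤)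
    {τ : ℝ} (hτ : 0 < τ) (n : ℕ) : ‖r.evalOp A τ ^ n‖ ≤ (stabilityConst r A).toReal := by
  have h1 : ‖r.evalOp A τ ^ n‖ₑ ≤ stabilityConst r A := by
    unfold stabilityConst
    exact le_iSup_of_le τ (le_iSup_of_le hτ (le_iSup (fun n => ‖r.evalOp A τ ^ n‖ₑ) n))
  have := ENNReal.toReal_mono h.ne h1
  simpa using this

/-- The step of the RL method from the value `v` at the time `t`. -/
def rlStep (r : SimpleFractions) (A : X →ₗ.[ℂ] X) (K : Y →L[ℂ] X) {p : ℕ} (τ t : ℝ)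
    (c : Fin p → ℝ) (d : Fin (p + 1) → ℝ) (f : ℝ → X) (g : ℝ → Y) (v : X) : X :=
  r.evalOp A τ v + (τ : ℂ) • opE r A τ t c f - opF r A K τ t d g

theorem rlStep_eq (r : SimpleFractions) (A : X →ₗ.[ℂ] X) (K : Y →L[ℂ] X) {p : ℕ} (τ t : ℝ)
    (c : Fin p → ℝ) (d : Fin (p + 1) → ℝ) (f : ℝ → X) (g : ℝ → Y) (v : X) :
    rlStep r A K τ t c d f g v = r.rInf • v + ∑ l, ∑ j ∈ Finset.Icc 1 (r.m l), r.coeff l j •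
      ((invOneSub A ((τ : ℂ) * r.w l) ^ j) v + r.w l • ∑ i ∈ Finset.Icc 1 j,
        (invOneSub A ((τ : ℂ) * r.w l) ^ (j - i + 1))
          ((τ : ℂ) • ∑ s, gammaWeights r c l i s • f (t + τ * c s) -
            K (∑ s, etaWeights r d l i s • g (t + τ * d s)))) := by
  obtain ⟨Γ, hΓ⟩ : ∃ Γ : Fin r.k → ℕ → X, ∀ l i,
      ∑ s, gammaWeights r c l i s • f (t + τ * c s) = Γ l i := ⟨_, fun _ _ => rfl⟩
  obtain ⟨Θ, hΘ⟩ : ∃ Θ : Fin r.k → ℕ → X, ∀ l i,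
      K (∑ s, etaWeights r d l i s • g (t + τ * d s)) = Θ l i := ⟨_, fun _ _ => rfl⟩
  simp only [rlStep, SimpleFractions.evalOp, opE, opF, hΓ, hΘ, add_apply, smul_apply,
    ContinuousLinearMap.id_apply, sum_apply, map_sub, map_smul, smul_add, smul_sub,
    Finset.sum_add_distrib, Finset.sum_sub_distrib, Finset.smul_sum, smul_smul]
  simp only [mul_comm, mul_assoc]
  abel

theorem SimpleFractions.HasOrder.sum_smul {r : SimpleFractions} {q : ℕ} (hord : r.HasOrder q)
    (τ : ℂ) (b : ℕ → X) :
    ∑ k ∈ Finset.range (q + 1), (τ ^ k / (k.factorial : ℂ)) • b k =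
      r.rInf • b 0 + ∑ l, ∑ j ∈ Finset.Icc 1 (r.m l), r.coeff l j •
        ∑ k ∈ Finset.range (q + 1), (resolventCoeff (r.w l) j k * τ ^ k) • b k := by
  have h1 : ∀ k ∈ Finset.range (q + 1), (τ ^ k / (k.factorial : ℂ)) • b k =
      (if k = 0 then r.rInf • b 0 else 0) + ∑ l, ∑ j ∈ Finset.Icc 1 (r.m l),
        (r.coeff l j * (resolventCoeff (r.w l) j k * τ ^ k)) • b k := fun k hk => by
    rw [div_eq_mul_inv, ← hord.sum_coeff (by have := Finset.mem_range.1 hk; omega), mul_add,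
      add_smul]
    congr 1
    · split_ifs with h
      · simp [h]
      · simp
    · simp only [Finset.mul_sum, Finset.sum_smul]
      refine Finset.sum_congr rfl fun l _ => Finset.sum_congr rfl fun j _ => ?_
      ring_nf
  rw [Finset.sum_congr rfl h1, Finset.sum_add_distrib]
  congr 1
  · simp
  · rw [Finset.sum_comm]
    refine Finset.sum_congr rfl fun l _ => ?_
    rw [Finset.sum_comm]
    refine Finset.sum_congr rfl fun j _ => ?_
    rw [Finset.smul_sum]
    simp only [smul_smul]

theorem norm_stage_sub_le {K : Y →L[ℂ] X} {q : ℕ} {w : ℂ} {i : ℕ} {τ κ N C₁ C₂ : ℝ} (hτ : 0 < τ)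
    (hκ : 0 ≤ κ) (hN : 0 ≤ N) (hC₁ : 0 ≤ C₁) (hC₂ : 0 ≤ C₂) {x : X} {y : Y} {a : ℕ → X} {b : ℕ → Y}
    (hx : ‖x - ∑ k ∈ Finset.range (q + 2), (resolventCoeff w i k * (τ : ℂ) ^ k) • a k‖ ≤
      C₁ * (1 + κ) * (τ ^ (q + 1) * N))
    (hy : ‖y - ∑ k ∈ Finset.range (q + 3), (mulResolventCoeff w i k * (τ : ℂ) ^ k) • b k‖ ≤
      C₂ * (1 + κ) * (τ ^ (q + 2) * N)) :
    ‖((τ : ℂ) • x - K y) - (τ : ℂ) • ∑ k ∈ Finset.range (q + 2),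
      (resolventCoeff w i k * (τ : ℂ) ^ k) • (a k - K (b (k + 1)))‖ ≤
      (C₁ + C₂) * ((1 + κ) * (1 + ‖K‖) * (τ ^ (q + 2) * N)) := by
  -- The factor `z` in `z (1 - w z)^{-i}` removes the constant term and shifts the index, so that
  -- `g^(k+1)` comes with `τ^(k+1)` and joins `τ f^(k)`.
  have h1 : K (∑ k ∈ Finset.range (q + 3), (mulResolventCoeff w i k * (τ : ℂ) ^ k) • b k) =
      (τ : ℂ) • ∑ k ∈ Finset.range (q + 2), (resolventCoeff w i k * (τ : ℂ) ^ k) • K (b (k + 1)) := by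
    rw [Finset.sum_range_succ']
    simp only [mulResolventCoeff, zero_mul, zero_smul, add_zero, map_sum, map_smul,
      Finset.smul_sum, smul_smul]
    refine Finset.sum_congr rfl fun k _ => ?_
    ring_nf
  have h2 : ((τ : ℂ) • x - K y) - (τ : ℂ) • ∑ k ∈ Finset.range (q + 2),
      (resolventCoeff w i k * (τ : ℂ) ^ k) • (a k - K (b (k + 1))) =
      (τ : ℂ) • (x - ∑ k ∈ Finset.range (q + 2), (resolventCoeff w i k * (τ : ℂ) ^ k) • a k) -
      K (y - ∑ k ∈ Finset.range (q + 3), (mulResolventCoeff w i k * (τ : ℂ) ^ k) • b k) := by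
    rw [map_sub, h1]
    simp only [smul_sub, Finset.sum_sub_distrib]
    abel
  rw [h2]
  refine (norm_sub_le _ _).trans ?_
  have h3 := mul_le_mul_of_nonneg_left hx hτ.le
  have h4 := (K.le_opNorm (y - ∑ k ∈ Finset.range (q + 3),
    (mulResolventCoeff w i k * (τ : ℂ) ^ k) • b k)).trans
    (mul_le_mul_of_nonneg_left hy (norm_nonneg K))
  rw [norm_smul, Complex.norm_real, Real.norm_of_nonneg hτ.le]
  refine (add_le_add h3 h4).trans ?_
  have h5 : 0 ≤ (C₁ * ‖K‖ + C₂) * ((1 + κ) * (τ ^ (q + 2) * N)) := by positivity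
  have h6 : (C₁ + C₂) * ((1 + κ) * (1 + ‖K‖) * (τ ^ (q + 2) * N)) =
      τ * (C₁ * (1 + κ) * (τ ^ (q + 1) * N)) + ‖K‖ * (C₂ * (1 + κ) * (τ ^ (q + 2) * N)) +
      (C₁ * ‖K‖ + C₂) * ((1 + κ) * (τ ^ (q + 2) * N)) := by ring
  linarith

end LocalError

theorem exists_local_error_bound (r : SimpleFractions) (q : ℕ) (hord : r.HasOrder (q + 1)) :
    ∃ C : ℝ, 0 ≤ C ∧ ∀ (X : Type*) [NormedAddCommGroup X] [NormedSpace ℂ X]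
      (Y : Type*) [NormedAddCommGroup Y] [NormedSpace ℂ Y] (A : X →ₗ.[ℂ] X) (K : Y →L[ℂ] X)
      (M τ t T N : ℝ) (κ : ℝ≥0) (c : Fin (q + 1) → ℝ) (d : Fin (q + 1 + 1) → ℝ)
      (f : ℝ → X) (g : ℝ → Y) (u : ℝ → X), 1 ≤ M → 0 < τ → 0 ≤ t → t ≤ T →
      (∀ l, IsInverseOneSub A ((τ : ℂ) * r.w l) (invOneSub A ((τ : ℂ) * r.w l))) →
      (∀ l m, ‖invOneSub A ((τ : ℂ) * r.w l) ^ m‖ ≤ (‖r.w l‖ / (r.w l).re) ^ m * M) →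
      IsNodeConst r c d κ → (∀ s, t + τ * c s ∈ Icc 0 T) → (∀ s, t + τ * d s ∈ Icc 0 T) →
      IsSolution A K f g u → ContDiffOn ℝ (q + 2 : ℕ) u (Ici 0) →
      ContDiffOn ℝ (q + 2 : ℕ) f (Ici 0) → ContDiffOn ℝ (q + 3 : ℕ) g (Ici 0) →
      (∀ s ∈ Icc t (t + τ), ‖iteratedDerivWithin (q + 2) u (Ici 0) s‖ ≤ N) →
      (∀ k ≤ q + 2, ∀ s ∈ Icc 0 T, ‖iteratedDerivWithin k f (Ici 0) s‖ ≤ N) →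
      (∀ k ≤ q + 3, ∀ s ∈ Icc 0 T, ‖iteratedDerivWithin k g (Ici 0) s‖ ≤ N) →
      ‖u (t + τ) - rlStep r A K τ t c d f g (u t)‖ ≤
        C * (M * ((1 + κ) * (1 + ‖K‖) * (τ ^ (q + 2) * N))) := by
  choose C₁ hC₁ hγ using fun l i => exists_gamma_quadrature_bound r q l i
  -- One order higher than for `γ`, because the sums over `g` are not multiplied by `τ`.
  choose C₂ hC₂ hη using fun l i => exists_eta_quadrature_bound r (q + 1) l i
  set B : Fin r.k → ℕ → ℝ := fun l j => ∑ i ∈ Finset.Icc 1 j, ‖r.w l‖ *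
    (‖r.w l‖ / (r.w l).re) ^ (j - i + 1) *
      (‖resolventCoeff (r.w l) i (q + 1)‖ + (C₁ l i + C₂ l (i - 1))) with hB
  have hB0 : ∀ l j, 0 ≤ B l j := fun l j => Finset.sum_nonneg fun i _ => by
    have := (r.re_w_pos l).le
    have := hC₁ l i
    have := hC₂ l (i - 1)
    positivity
  -- The `1` pays for the Taylor remainder of `u`, the sum for the errors of the individual
  -- fractions.
  refine ⟨1 + ∑ l, ∑ j ∈ Finset.Icc 1 (r.m l), ‖r.coeff l j‖ * B l j,
    add_nonneg zero_le_one (Finset.sum_nonneg fun l _ => Finset.sum_nonneg fun j _ =>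
      mul_nonneg (norm_nonneg _) (hB0 l j)), ?_⟩
  intro X _ _ Y _ _ A K M τ t T N κ c d f g u hM hτ ht htT hJ hJM hκ hc hd hsol hu hf hg huN hfN hgN
  have hN0 : 0 ≤ N := (norm_nonneg _).trans (huN t ⟨le_rfl, by linarith⟩)
  set R := (1 + (κ : ℝ)) * (1 + ‖K‖) * (τ ^ (q + 2) * N) with hR
  have hτN : τ ^ (q + 2) * N ≤ R := by
    rw [hR]
    refine le_mul_of_one_le_left (by positivity) ?_
    have h1 : 0 ≤ (κ : ℝ) := κ.2
    have h2 : 0 ≤ ‖K‖ := norm_nonneg K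
    nlinarith [mul_nonneg h1 h2]
  set b : ℕ → X := fun k => iteratedDerivWithin k u (Ici 0) t with hb
  set e : ℕ → X := fun k => iteratedDerivWithin k f (Ici 0) t -
    K (iteratedDerivWithin (k + 1) g (Ici 0) t) with he
  have hstage : ∀ l, ∀ j ∈ Finset.Icc 1 (r.m l),
      ‖(invOneSub A ((τ : ℂ) * r.w l) ^ j) (b 0) + r.w l • ∑ i ∈ Finset.Icc 1 j,
        (invOneSub A ((τ : ℂ) * r.w l) ^ (j - i + 1))
          ((τ : ℂ) • ∑ s, gammaWeights r c l i s • f (t + τ * c s) -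
            K (∑ s, etaWeights r d l i s • g (t + τ * d s))) -
        ∑ k ∈ Finset.range (q + 2), (resolventCoeff (r.w l) j k * (τ : ℂ) ^ k) • b k‖ ≤
      B l j * (M * R) := by
    intro l j hj
    refine norm_resolvent_pow_add_sum_sub_le (q := q + 1) (e := e)
      (D := fun i => C₁ l i + C₂ l (i - 1))
      (fun k hk => hsol.resolvent_jet (hJ l) hu hf hg k hk t ht) (hJM l) ?_ fun i hi => ?_
    · rw [norm_smul, norm_pow, Complex.norm_real, Real.norm_of_nonneg hτ.le]
      refine le_trans ?_ hτN
      gcongr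
      exact huN t ⟨le_rfl, by linarith⟩
    · obtain ⟨i, rfl⟩ : ∃ i', i = i' + 1 := ⟨i - 1, by have := (Finset.mem_Icc.1 hi).1; omega⟩
      have him : i + 1 ∈ Finset.Icc 1 (r.m l) := Finset.mem_Icc.2
        ⟨by omega, (Finset.mem_Icc.1 hi).2.trans (Finset.mem_Icc.1 hj).2⟩
      have h1 := norm_sum_sub_sum_le_of_scalar
        (hγ l (i + 1) c d κ hκ him τ t T N hτ ht htT (fun s => (hc s).1) fun s => (hc s).2)
        (hf.isJet (uniqueDiffOn_Ici 0)) hfN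
      have h2 := norm_sum_sub_sum_le_of_scalar
        (hη l i c d κ hκ him τ t T N hτ ht htT (fun s => (hd s).1) fun s => (hd s).2)
        (hg.isJet (uniqueDiffOn_Ici 0)) hgN
      simp only [iteratedDerivWithin_zero] at h1 h2
      rw [show q + 1 + 2 = q + 3 from rfl] at h2
      have h3 := norm_stage_sub_le (K := K) (a := fun k => iteratedDerivWithin k f (Ici 0) t)
        (b := fun k => iteratedDerivWithin k g (Ici 0) t) hτ κ.2 hN0 (hC₁ l (i + 1)) (hC₂ l i) h1 h2
      rw [Nat.add_sub_cancel]
      exact h3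
  have htaylor : ‖u (t + τ) - ∑ k ∈ Finset.range (q + 2),
      ((τ : ℂ) ^ k / (k.factorial : ℂ)) • b k‖ ≤ τ ^ (q + 2) * N := by
    have hjet : IsJet (q + 2) (Icc t (t + τ)) fun k => iteratedDerivWithin k u (Ici 0) :=
      (hu.isJet (uniqueDiffOn_Ici 0)).subset fun y hy => mem_Ici.2 (ht.trans hy.1)
    have h1 := hjet.taylor (t := t) (x := t + τ) (left_mem_Icc.2 (by linarith))
      (right_mem_Icc.2 (by linarith)) huN
    rw [add_sub_cancel_left, abs_of_pos hτ, iteratedDerivWithin_zero] at h1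
    refine le_trans (le_of_eq ?_) h1
    congr 2
    refine Finset.sum_congr rfl fun k _ => ?_
    rw [← Complex.coe_smul]
    push_cast
    rfl
  rw [rlStep_eq]
  have hsum := hord.sum_smul (τ : ℂ) b
  have hb0 : b 0 = u t := by simp [hb]
  rw [hb0] at hsum hstage
  have hsplit : u (t + τ) - (r.rInf • u t + ∑ l, ∑ j ∈ Finset.Icc 1 (r.m l), r.coeff l j •
      ((invOneSub A ((τ : ℂ) * r.w l) ^ j) (u t) + r.w l • ∑ i ∈ Finset.Icc 1 j,
        (invOneSub A ((τ : ℂ) * r.w l) ^ (j - i + 1))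
          ((τ : ℂ) • ∑ s, gammaWeights r c l i s • f (t + τ * c s) -
            K (∑ s, etaWeights r d l i s • g (t + τ * d s))))) =
      (u (t + τ) - ∑ k ∈ Finset.range (q + 2), ((τ : ℂ) ^ k / (k.factorial : ℂ)) • b k) -
      ∑ l, ∑ j ∈ Finset.Icc 1 (r.m l), r.coeff l j •
      ((invOneSub A ((τ : ℂ) * r.w l) ^ j) (u t) + r.w l • ∑ i ∈ Finset.Icc 1 j,
        (invOneSub A ((τ : ℂ) * r.w l) ^ (j - i + 1))
          ((τ : ℂ) • ∑ s, gammaWeights r c l i s • f (t + τ * c s) -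
            K (∑ s, etaWeights r d l i s • g (t + τ * d s))) -
        ∑ k ∈ Finset.range (q + 2), (resolventCoeff (r.w l) j k * (τ : ℂ) ^ k) • b k) := by
    rw [hsum]
    simp only [smul_sub (r.coeff _ _) _
      (∑ k ∈ Finset.range (q + 2), _), Finset.sum_sub_distrib]
    abel
  rw [hsplit, add_mul, one_mul, Finset.sum_mul]
  have hR0 : 0 ≤ R := by positivity
  refine (norm_sub_le _ _).trans (add_le_add (htaylor.trans (hτN.trans
    (le_mul_of_one_le_left hR0 hM))) ?_)
  refine norm_sum_le_of_le _ fun l _ => ?_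
  rw [Finset.sum_mul]
  refine norm_sum_le_of_le _ fun j hj => ?_
  rw [norm_smul, mul_assoc]
  exact mul_le_mul_of_nonneg_left (hstage l j hj) (norm_nonneg _)

end

/-! ### Global error: stability and absorption of the constants. -/

theorem mainTheorem1 (r : SimpleFractions) (p : ℕ) (hp : 1 ≤ p)
    (hA : r.AAcceptable) (hord : r.HasOrder p) :
    (∀ (c : Fin p → ℝ) (d : Fin (p + 1) → ℝ), Function.Injective c → Function.Injective d →
      nodeConst r c d < ⊤) ∧
    ∃ Cel Caux : ℝ, 0 < Cel ∧ 0 < Caux ∧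
      ∀ (X : Type*) [NormedAddCommGroup X] [NormedSpace ℂ X] [CompleteSpace X]
        (Y : Type*) [NormedAddCommGroup Y] [NormedSpace ℂ Y] [CompleteSpace Y]
        (A₀ : X →ₗ.[ℂ] X) (S : C0Semigroup X) (M ω : ℝ) (K : Y →L[ℂ] X),
        IsInfinitesimalGenerator A₀ S → 1 ≤ M → ω < 0 →
        (∀ t : ℝ, 0 ≤ t → ‖S.toFun t‖ ≤ M * Real.exp (ω * t)) →
        stabilityConst r A₀ < ⊤ →
        ∀ (τ : ℝ) (c : ℕ → Fin p → ℝ) (d : ℕ → Fin (p + 1) → ℝ), 0 < τ →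
        (∀ n, Function.Injective (c n)) → (∀ n, Function.Injective (d n)) →
        (∀ n i, 0 ≤ n * τ + τ * c n i) → (∀ n i, 0 ≤ n * τ + τ * d n i) →
        (⨆ n, nodeConst r (c n) (d n)) < ⊤ →
        ∀ (f : ℝ → X) (g : ℝ → Y) (u : ℝ → X),
        IsSolution A₀ K f g u →
        ContDiffOn ℝ ((p + 1 : ℕ) : WithTop ℕ∞) u (Ici 0) →
        ContDiffOn ℝ ((p + 1 : ℕ) : WithTop ℕ∞) f (Ici 0) →
        ContDiffOn ℝ ((p + 2 : ℕ) : WithTop ℕ∞) g (Ici 0) →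
        ∀ (n : ℕ) (T : ℝ), 1 ≤ n → n * τ ≤ T →
        (∀ j < n, (∀ i, j * τ + τ * c j i ≤ T) ∧ ∀ i, j * τ + τ * d j i ≤ T) →
        ‖u (n * τ) - rlMethod r A₀ K τ c d f g (u 0) n‖ ≤
          (stabilityConst r A₀).toReal * M *
              (Cel + (⨆ n, nodeConst r (c n) (d n)).toReal * Caux * (1 + ‖K‖)) *
            τ ^ p * (n * τ) * (1 + 2 * (n * τ)) *
            (cmNorm (p + 1) (n * τ) u + cmNorm (p + 1) T f + cmNorm (p + 2) T g) := by
  refine ⟨fun c d hc hd => nodeConst_lt_top hp hc hd, ?_⟩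
  obtain ⟨l, hl⟩ := hord.exists_one_le_m hp
  obtain ⟨q, rfl⟩ : ∃ q, p = q + 1 := ⟨p - 1, by omega⟩
  obtain ⟨κ₀, hκ₀, hlow⟩ := exists_pos_le_of_isNodeConst r (q + 1) hl
  obtain ⟨C, hC, hloc⟩ := exists_local_error_bound r q hord
  -- The whole error is charged to the term with `κ`; the constant `C_el` only has to be positive.
  refine ⟨1, (C + 1) * (κ₀⁻¹ + 1), one_pos, by positivity, ?_⟩
  intro X _ _ _ Y _ _ _ A₀ S M ω K hgen hM hω hS hstab τ c d hτ hc hd hc0 hd0 hκ f g u hsol hu hf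
    hg n T _ hnT hT
  have hSM : ∀ t, 0 ≤ t → ‖S.toFun t‖ ≤ M := fun t ht => (hS t ht).trans <|
    mul_le_of_le_one_right (zero_le_one.trans hM)
      (Real.exp_le_one_iff.2 (mul_nonpos_of_nonpos_of_nonneg hω.le ht))
  have hz : ∀ l, 0 < ((τ : ℂ) * r.w l).re := fun l => re_ofReal_mul_pos hτ (r.re_w_pos l)
  set κ := (⨆ n, nodeConst r (c n) (d n)).toNNReal with hκdef
  have hnode : ∀ j, IsNodeConst r (c j) (d j) κ := fun j =>
    isNodeConst_toNNReal hκ.ne (le_iSup (fun n => nodeConst r (c n) (d n)) j)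
  change _ ≤ (stabilityConst r A₀).toReal * M *
    (1 + (κ : ℝ) * ((C + 1) * (κ₀⁻¹ + 1)) * (1 + ‖K‖)) * _ * _ * _ * _
  set Cs := (stabilityConst r A₀).toReal
  set N := cmNorm (q + 1 + 1) (n * τ) u + cmNorm (q + 1 + 1) T f + cmNorm (q + 1 + 2) T g
  have hNu := cmNorm_nonneg (q + 1 + 1) (n * τ) u
  have hNf := cmNorm_nonneg (q + 1 + 1) T f
  have hNg := cmNorm_nonneg (q + 1 + 2) T g
  have hN0 : 0 ≤ N := by positivity
  have hCs0 : 0 ≤ Cs := ENNReal.toReal_nonneg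
  have hκ0 : 0 ≤ (κ : ℝ) := κ.2
  have hM0 : 0 ≤ M := zero_le_one.trans hM
  have hstep : ∀ j < n, ‖(u ((j + 1 : ℕ) * τ) - rlMethod r A₀ K τ c d f g (u 0) (j + 1)) -
      r.evalOp A₀ τ (u (j * τ) - rlMethod r A₀ K τ c d f g (u 0) j)‖ ≤
      C * (M * ((1 + κ) * (1 + ‖K‖) * (τ ^ (q + 2) * N))) := by
    intro j hj
    have hjn : ((j + 1 : ℕ) : ℝ) * τ ≤ n * τ :=
      mul_le_mul_of_nonneg_right (by exact_mod_cast hj) hτ.le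
    have hj1 : ((j + 1 : ℕ) : ℝ) * τ = j * τ + τ := by push_cast; ring
    have hj0 : 0 ≤ (j : ℝ) * τ := by positivity
    have h1 := hloc X Y A₀ K M τ (j * τ) T N κ (c j) (d j) f g u hM hτ hj0 (by linarith)
      (fun l => hgen.isInverseOneSub_invOneSub hSM (hz l))
      (fun l m => by
        rw [← norm_div_re_ofReal_mul hτ (r.w l)]
        exact hgen.norm_invOneSub_pow_le hSM (hz l) m)
      (hnode j) (fun s => ⟨hc0 j s, (hT j hj).1 s⟩) (fun s => ⟨hd0 j s, (hT j hj).2 s⟩)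
      hsol hu hf hg
      (fun s hs => (norm_iteratedDerivWithin_le_cmNorm (T := n * τ) hu le_rfl
        ⟨hj0.trans hs.1, by linarith [hs.2]⟩).trans (by linarith))
      (fun k hk s hs => (norm_iteratedDerivWithin_le_cmNorm hf hk hs).trans (by linarith))
      (fun k hk s hs => (norm_iteratedDerivWithin_le_cmNorm hg hk hs).trans (by linarith))
    rw [hj1]
    refine le_trans (le_of_eq ?_) h1
    congr 1
    simp only [rlMethod, rlStep, map_sub]
    abel
  have key := norm_le_of_stable_recursion (norm_pow_evalOp_le hstab hτ)
    (e := fun j => u (j * τ) - rlMethod r A₀ K τ c d f g (u 0) j) (by simp [rlMethod]) hstep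
  refine key.trans ?_
  -- Since `κ₀ ≤ κ`, the summand `1` is at most `κ κ₀⁻¹`.
  have hκle : C * (1 + (κ : ℝ)) ≤ κ * ((C + 1) * (κ₀⁻¹ + 1)) := by
    have h1 := hlow _ _ _ (hnode 0)
    have h2 : 1 ≤ (κ : ℝ) * κ₀⁻¹ := by
      rw [← div_eq_mul_inv, one_le_div hκ₀]
      exact h1
    nlinarith [mul_le_mul_of_nonneg_left h2 hC, mul_nonneg hC hκ0, inv_pos.2 hκ₀]
  have hnτ : 0 ≤ (n : ℝ) * τ := by positivity
  calc (n : ℝ) * (Cs * (C * (M * ((1 + κ) * (1 + ‖K‖) * (τ ^ (q + 2) * N)))))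
      = Cs * M * (C * (1 + κ) * (1 + ‖K‖)) * τ ^ (q + 1) * (n * τ) * 1 * N := by ring
    _ ≤ Cs * M * (1 + κ * ((C + 1) * (κ₀⁻¹ + 1)) * (1 + ‖K‖)) * τ ^ (q + 1) * (n * τ) *
        (1 + 2 * (n * τ)) * N := by
      gcongr
      · exact (mul_le_mul_of_nonneg_right hκle (by positivity)).trans (by linarith)
      · linarith
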